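/- Let $(Y_k)_{k\ge 1}$ be i.i.d. real random variables, and let $\ell$ be slowly varying at $\infty$, i.e. $\ell$ is positive and measurable on some half-line $[X,\infty)$ and $\ell(rx)/\ell(x)\to 1$ as $x\to\infty$ for every $r>0$. Assume that $P(Y_1^2>x)\sim \ell(x)x^{-1}$ as $x\to\infty$ and that $E Y_1^2=\infty$. Put $\delta_{1,n}=Y_1/V_n$ with $V_n=\big(\sum_{k=1}^n Y_k^2\big)^{1/2}$ (and $\delta_{1,n}=0$ where $V_n=0$), and let $L(x)=\int_c^x \frac{\ell(t)}{t}\,dt$, where $c\ge 0$ is any lower limit such that $\ell(t)/t$ is integrable over $[c,x]$ for all $x\ge c$; such $c$ exist. Then there is a sequence $(a_n)$ with $a_n\to\infty$ and $a_n\sim nL(a_n)$ as $n\to\infty$, and for every such sequence and every $\gamma>1$, $$ nE|\delta_{1,n}|^{2\gamma}\;\sim\;\frac{1}{\gamma-1}\,\frac{\ell(a_n)}{L(a_n)}\qquad (n\to\infty). $$ -/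

import Mathlib

open MeasureTheory ProbabilityTheory Filter Topology Asymptotics

noncomputable section

/-- `ℓ` is slowly varying at infinity: on some half-line `[X, ∞)` it is positive and measurable,
and `ℓ (r x) / ℓ x → 1` as `x → ∞` for every `r > 0`. -/
def SlowlyVarying (ℓ : ℝ → ℝ) : Prop :=
  (∃ X : ℝ, (∀ x, X ≤ x → 0 < ℓ x) ∧ Measurable fun x : Set.Ici X => ℓ x) ∧
    ∀ r : ℝ, 0 < r → Tendsto (fun x => ℓ (r * x) / ℓ x) atTop (𝓝 1)

/-- `c ≥ 0` is an admissible lower limit for the integral `∫^x ℓ(t)/t dt`: the integrand is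
integrable over `[c, x]` for every `x ≥ c`. -/
def AdmissibleLowerLimit (ℓ : ℝ → ℝ) (c : ℝ) : Prop :=
  0 ≤ c ∧ ∀ x, c ≤ x → IntervalIntegrable (fun t => ℓ t / t) volume c x

/-- `L(x) = ∫_c^x ℓ(t)/t dt`. -/
def tailIntegral (ℓ : ℝ → ℝ) (c x : ℝ) : ℝ :=
  ∫ t in c..x, ℓ t / t

/-- `a_n → ∞` and `a_n ∼ n L(a_n)`. -/
def IsNormingSequence (L : ℝ → ℝ) (a : ℕ → ℝ) : Prop :=
  Tendsto a atTop atTop ∧ a ~[atTop] fun n => (n : ℝ) * L (a n)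

/-- `V_n = (∑_{k=1}^n Y_k²)^{1/2}`. The sequence is indexed from `0`, so `Y_k` is
`Y (k - 1)`. -/
def selfNorm {Ω : Type*} (Y : ℕ → Ω → ℝ) (n : ℕ) (ω : Ω) : ℝ :=
  √(∑ k ∈ Finset.range n, Y k ω ^ 2)

/-- `δ_{k+1,n} = Y_{k+1} / V_n` (equal to `0` where `V_n = 0`). -/
def selfNormRatio {Ω : Type*} (Y : ℕ → Ω → ℝ) (k n : ℕ) (ω : Ω) : ℝ :=
  Y k ω / selfNorm Y n ω

end

/-- Potter's lower bound for a positive antitone function `f` with `f (2x) / f x → 1/2`. -/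
lemma exists_rpow_mul_le_of_tendsto_half {f : ℝ → ℝ} (hf : Antitone f) (hpos : ∀ x, 0 < f x)
    (h2 : Tendsto (fun x => f (2 * x) / f x) atTop (𝓝 2⁻¹)) {s : ℝ} (hs0 : 0 < s) (hs : s < 1) :
    ∃ x₀ > 0, ∀ y z, x₀ ≤ y → y ≤ z → (z / y) ^ s * f z ≤ 2 ^ s * f y := by
  have hlt : (2⁻¹ : ℝ) < (2 : ℝ) ^ (-s) := by
    rw [← Real.rpow_neg_one]
    exact Real.rpow_lt_rpow_of_exponent_lt (by norm_num) (by linarith)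
  obtain ⟨x₁, hx₁⟩ := eventually_atTop.1 (h2.eventually_lt_const hlt)
  refine ⟨max x₁ 1, by positivity, ?_⟩
  have step : ∀ x, max x₁ 1 ≤ x → 2 ^ s * f (2 * x) ≤ f x := by
    intro x hx
    have h := hx₁ x ((le_max_left _ _).trans hx)
    rw [div_lt_iff₀ (hpos x), Real.rpow_neg (by norm_num)] at h
    have : (0 : ℝ) < 2 ^ s := by positivity
    calc (2 : ℝ) ^ s * f (2 * x) ≤ 2 ^ s * ((2 ^ s)⁻¹ * f x) := by gcongr
      _ = f x := by field_simp
  have key : ∀ (j : ℕ) (y z : ℝ), max x₁ 1 ≤ y → y ≤ z → z ≤ 2 ^ j * y →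
      (z / y) ^ s * f z ≤ 2 ^ s * f y := by
    intro j
    induction j with
    | zero =>
      intro y z hy hyz hz
      have hy0 : 0 < y := lt_of_lt_of_le (by positivity) hy
      have : z = y := by simp at hz; linarith
      subst this
      rw [div_self hy0.ne', Real.one_rpow]
      have : (1 : ℝ) ≤ 2 ^ s := Real.one_le_rpow (by norm_num) hs0.le
      have := hpos z
      nlinarith
    | succ j ih =>
      intro y z hy hyz hz
      have hy0 : 0 < y := lt_of_lt_of_le (by positivity) hy
      rcases le_or_gt z (2 * y) with h | h
      · have : z / y ≤ 2 := by rwa [div_le_iff₀ hy0]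
        have h0 : 0 ≤ z / y := div_nonneg (hy0.le.trans hyz) hy0.le
        exact mul_le_mul (Real.rpow_le_rpow h0 this hs0.le) (hf hyz) (hpos z).le (by positivity)
      · have h1 := ih (2 * y) z (by linarith) h.le (by rw [pow_succ] at hz; linarith)
        have h2 := step y hy
        have h3 : z / y = 2 * (z / (2 * y)) := by field_simp
        have hz0 : 0 < z := by linarith
        rw [h3, Real.mul_rpow (by norm_num) (by positivity), mul_assoc]
        gcongr
        exact h1.trans h2
  intro y z hy hyz
  have hy0 : 0 < y := lt_of_lt_of_le (by positivity) hy
  obtain ⟨j, hj⟩ := pow_unbounded_of_one_lt (z / y) (one_lt_two)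
  exact key j y z hy hyz (by rw [div_lt_iff₀ hy0] at hj; exact hj.le)

/-- Potter's upper bound for a bounded positive antitone function `f` with
`f (2x) / f x → 1/2`. -/
lemma exists_le_rpow_mul_of_tendsto_half {f : ℝ → ℝ} (hf : Antitone f) (hpos : ∀ x, 0 < f x)
    (hb : ∀ x, f x ≤ 1) (h2 : Tendsto (fun x => f (2 * x) / f x) atTop (𝓝 2⁻¹))
    {s : ℝ} (hs : 1 < s) :
    ∃ C > 0, ∀ x z, 0 < x → 0 < z → f (z * x) ≤ C * (1 + x ^ (-s)) * f z := by
  have hlt : (2 : ℝ) ^ (-s) < (2⁻¹ : ℝ) := by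
    rw [← Real.rpow_neg_one]
    exact Real.rpow_lt_rpow_of_exponent_lt (by norm_num) (by linarith)
  have hs0 : 0 < s := by linarith
  have h2s : (1 : ℝ) ≤ 2 ^ s := Real.one_le_rpow (by norm_num) hs0.le
  obtain ⟨x₁, hx₁⟩ := eventually_atTop.1 (h2.eventually_const_lt hlt)
  set x₀ := max x₁ 1 with hx₀
  have hx0 : 0 < x₀ := by positivity
  have step : ∀ x, x₀ ≤ x → f x ≤ 2 ^ s * f (2 * x) := by
    intro x hx
    have h := hx₁ x ((le_max_left _ _).trans hx)
    rw [lt_div_iff₀ (hpos x), Real.rpow_neg (by norm_num)] at h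
    have : (0 : ℝ) < 2 ^ s := by positivity
    calc f x = 2 ^ s * ((2 ^ s)⁻¹ * f x) := by field_simp
      _ ≤ _ := by gcongr
  have key : ∀ (j : ℕ) (y z : ℝ), x₀ ≤ y → y ≤ z → z ≤ 2 ^ j * y →
      f y ≤ 2 ^ s * (z / y) ^ s * f z := by
    intro j
    induction j with
    | zero =>
      intro y z hy hyz hz
      have hy0 : 0 < y := lt_of_lt_of_le hx0 hy
      have : z = y := by simp at hz; linarith
      subst this
      rw [div_self hy0.ne', Real.one_rpow]
      have := hpos z
      nlinarith
    | succ j ih =>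
      intro y z hy hyz hz
      have hy0 : 0 < y := lt_of_lt_of_le hx0 hy
      have hz0 : 0 < z := by linarith
      rcases le_or_gt z (2 * y) with h | h
      · have h1 : 1 ≤ (z / y) ^ s :=
          Real.one_le_rpow (by rwa [le_div_iff₀ hy0, one_mul]) hs0.le
        calc f y ≤ 2 ^ s * f (2 * y) := step y hy
          _ ≤ 2 ^ s * f z := by gcongr; exact hf h
          _ ≤ 2 ^ s * (z / y) ^ s * f z := by
            have := hpos z
            gcongr
            nlinarith
      · have h1 := ih (2 * y) z (by linarith) h.le (by rw [pow_succ] at hz; linarith)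
        have h3 : z / y = 2 * (z / (2 * y)) := by field_simp
        rw [h3, Real.mul_rpow (by norm_num) (by positivity), mul_assoc]
        refine (step y hy).trans ?_
        gcongr
  have key' : ∀ y z, x₀ ≤ y → y ≤ z → f y ≤ 2 ^ s * (z / y) ^ s * f z := by
    intro y z hy hyz
    have hy0 : 0 < y := lt_of_lt_of_le hx0 hy
    obtain ⟨j, hj⟩ := pow_unbounded_of_one_lt (z / y) (one_lt_two)
    exact key j y z hy hyz (by rw [div_lt_iff₀ hy0] at hj; exact hj.le)
  have hfx := hpos x₀
  have hinv : 1 ≤ (f x₀)⁻¹ := (one_le_inv₀ hfx).2 (hb x₀)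
  refine ⟨2 ^ s * (f x₀)⁻¹, by positivity, fun x z hx hz => ?_⟩
  have hfz := hpos z
  have hxs : 0 < x ^ (-s) := by positivity
  have hC : 1 ≤ 2 ^ s * (f x₀)⁻¹ := one_le_mul_of_one_le_of_one_le h2s hinv
  rcases le_or_gt 1 x with h1 | h1
  · calc f (z * x) ≤ f z := hf (by nlinarith)
      _ ≤ (2 ^ s * (f x₀)⁻¹ * (1 + x ^ (-s))) * f z :=
        le_mul_of_one_le_left hfz.le (one_le_mul_of_one_le_of_one_le hC (by linarith))
  · have hx1 : 1 ≤ x ^ (-s) := by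
      rw [Real.rpow_neg hx.le, ← Real.inv_rpow hx.le]
      exact Real.one_le_rpow ((one_le_inv₀ hx).2 h1.le) hs0.le
    have hgoal : f (z * x) ≤ 2 ^ s * (f x₀)⁻¹ * x ^ (-s) * f z := by
      rcases le_or_gt x₀ (z * x) with h | h
      · have := key' (z * x) z h (by nlinarith)
        have he : (z / (z * x)) ^ s = x ^ (-s) := by
          rw [Real.rpow_neg hx.le, ← Real.inv_rpow hx.le]
          congr 1
          field_simp
        rw [he] at this
        refine this.trans ?_
        gcongr
        exact le_mul_of_one_le_right (by positivity) hinv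
      · rcases le_or_gt x₀ z with hz' | hz'
        · have h3 := key' x₀ z le_rfl hz'
          have h4 : (z / x₀) ^ s ≤ x ^ (-s) := by
            rw [Real.rpow_neg hx.le, ← Real.inv_rpow hx.le]
            apply Real.rpow_le_rpow (by positivity) _ hs0.le
            rw [div_le_iff₀ hx0, ← div_eq_inv_mul, le_div_iff₀ hx]
            exact h.le
          calc f (z * x) ≤ 1 := hb _
            _ = (f x₀)⁻¹ * f x₀ := by field_simp
            _ ≤ (f x₀)⁻¹ * (2 ^ s * (z / x₀) ^ s * f z) := by gcongr
            _ = 2 ^ s * (f x₀)⁻¹ * (z / x₀) ^ s * f z := by ring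
            _ ≤ _ := by gcongr
        · calc f (z * x) ≤ 1 := hb _
            _ = (f x₀)⁻¹ * f x₀ := by field_simp
            _ ≤ (f x₀)⁻¹ * f z := by gcongr; exact hf hz'.le
            _ ≤ (2 ^ s * x ^ (-s)) * ((f x₀)⁻¹ * f z) :=
              le_mul_of_one_le_left (by positivity) (one_le_mul_of_one_le_of_one_le h2s hx1)
            _ = _ := by ring
    refine hgoal.trans ?_
    gcongr
    linarith

/-- The average of `T` over `[0, z]`. -/
noncomputable def averageTail (T : ℝ → ℝ) (z : ℝ) : ℝ := ∫ x in (0 : ℝ)..1, T (z * x)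

section Average

variable {T : ℝ → ℝ}

lemma intervalIntegrable_comp_mul_of_antitone (hT : Antitone T) (hpos : ∀ x, 0 < T x)
    (hb : ∀ x, T x ≤ 1) (z a b : ℝ) :
    IntervalIntegrable (fun x => T (z * x)) volume a b := by
  have hm : Measurable fun x => T (z * x) := hT.measurable.comp (measurable_const_mul z)
  refine (intervalIntegrable_const (c := (1 : ℝ))).mono_fun hm.aestronglyMeasurable
    (Eventually.of_forall fun x => ?_)
  simpa [abs_of_pos (hpos _)] using hb _

lemma averageTail_antitone (hT : Antitone T) (hpos : ∀ x, 0 < T x) (hb : ∀ x, T x ≤ 1) :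
    Antitone (averageTail T) := by
  intro y z hyz
  refine intervalIntegral.integral_mono_on zero_le_one
    (intervalIntegrable_comp_mul_of_antitone hT hpos hb _ _ _)
    (intervalIntegrable_comp_mul_of_antitone hT hpos hb _ _ _) fun x hx => hT ?_
  exact mul_le_mul_of_nonneg_right hyz hx.1

lemma averageTail_pos (hT : Antitone T) (hpos : ∀ x, 0 < T x) (hb : ∀ x, T x ≤ 1) (z : ℝ) :
    0 < averageTail T z :=
  intervalIntegral.intervalIntegral_pos_of_pos
    (intervalIntegrable_comp_mul_of_antitone hT hpos hb _ _ _) (fun _ => hpos _) zero_lt_one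

lemma mul_averageTail (z : ℝ) : z * averageTail T z = ∫ t in (0 : ℝ)..z, T t := by
  simp [averageTail]

lemma averageTail_eq {z : ℝ} (hz : 0 < z) :
    averageTail T z = (∫ t in (0 : ℝ)..z, T t) / z := by
  rw [← mul_averageTail]; field_simp

lemma integral_sub_integral_le_of_antitone (hT : Antitone T) {y z : ℝ} (hyz : y ≤ z) :
    (∫ t in (0 : ℝ)..z, T t) - ∫ t in (0 : ℝ)..y, T t ≤ (z - y) * T y := by
  rw [intervalIntegral.integral_interval_sub_left hT.intervalIntegrable hT.intervalIntegrable]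
  calc ∫ t in y..z, T t ≤ ∫ t in y..z, T y :=
        intervalIntegral.integral_mono_on hyz hT.intervalIntegrable intervalIntegrable_const
          fun t ht => hT ht.1
    _ = _ := by simp

lemma le_integral_sub_integral_of_antitone (hT : Antitone T) {y z : ℝ} (hyz : y ≤ z) :
    (z - y) * T z ≤ (∫ t in (0 : ℝ)..z, T t) - ∫ t in (0 : ℝ)..y, T t := by
  rw [intervalIntegral.integral_interval_sub_left hT.intervalIntegrable hT.intervalIntegrable]
  calc (z - y) * T z = ∫ t in y..z, T z := by simp
    _ ≤ _ :=
        intervalIntegral.integral_mono_on hyz intervalIntegrable_const hT.intervalIntegrable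
          fun t ht => hT ht.2

lemma tendsto_div_averageTail (hT : Antitone T) (hpos : ∀ x, 0 < T x) (hb : ∀ x, T x ≤ 1)
    (hRV : ∀ r : ℝ, 0 < r → Tendsto (fun x => T (r * x) / T x) atTop (𝓝 r⁻¹)) :
    Tendsto (fun z => T z / averageTail T z) atTop (𝓝 0) := by
  have hN : ∀ N : ℕ, ∀ᶠ z in atTop, (N / 4 : ℝ) * (z * T z) ≤ ∫ t in (0 : ℝ)..z, T t := by
    intro N
    induction N with
    | zero =>
      filter_upwards [eventually_ge_atTop 0] with z hz
      simpa using intervalIntegral.integral_nonneg hz fun x _ => (hpos x).le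
    | succ N ih =>
      have hlim := hRV 2⁻¹ (by norm_num)
      have hlt : (2 : ℝ) - 2 / (N + 1) < 2⁻¹⁻¹ := by
        have : (0 : ℝ) < 2 / (N + 1) := by positivity
        norm_num [this]
      have hhalf : Tendsto (fun z : ℝ => 2⁻¹ * z) atTop atTop :=
        tendsto_id.const_mul_atTop (by norm_num)
      filter_upwards [hlim.eventually_const_lt hlt, hhalf.eventually ih, eventually_gt_atTop 0]
        with z h1 h2 hz
      have h3 := le_integral_sub_integral_of_antitone hT (show 2⁻¹ * z ≤ z by linarith)
      rw [lt_div_iff₀ (hpos z)] at h1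
      have h4 : (N / 4 : ℝ) * (2⁻¹ * z * ((2 - 2 / (N + 1)) * T z)) ≤
          (N / 4 : ℝ) * (2⁻¹ * z * T (2⁻¹ * z)) := by gcongr
      have h5 : ((N : ℝ) + 1) / 4 * (z * T z) ≤
          (N / 4 : ℝ) * (2⁻¹ * z * ((2 - 2 / (N + 1)) * T z)) + (z - 2⁻¹ * z) * T z := by
        have h6 : (N : ℝ) / (N + 1) ≤ 1 := by rw [div_le_one (by positivity)]; linarith
        have h7 : (N / 4 : ℝ) * (2⁻¹ * z * ((2 - 2 / (N + 1)) * T z)) =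
          (z * T z) * (N / 4 - N / (N + 1) / 4) := by ring
        rw [h7]
        have := mul_pos hz (hpos z)
        nlinarith
      push_cast
      linarith
  rw [Metric.tendsto_nhds]
  intro ε hε
  obtain ⟨N, hN'⟩ := exists_nat_gt (4 / ε)
  filter_upwards [hN N, eventually_gt_atTop 0] with z h1 hz
  have hA := averageTail_pos hT hpos hb z
  have hTz := hpos z
  rw [Real.dist_eq, sub_zero, abs_of_pos (by positivity), div_lt_iff₀ hA]
  rw [← mul_averageTail] at h1
  have h2 : (N / 4 : ℝ) * T z ≤ averageTail T z := by
    refine le_of_mul_le_mul_left ?_ hz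
    linarith
  have h3 : 1 < ε * (N / 4) := by
    rw [div_lt_iff₀ hε] at hN'
    linarith
  nlinarith

lemma tendsto_averageTail_mul_div (hT : Antitone T) (hpos : ∀ x, 0 < T x) (hb : ∀ x, T x ≤ 1)
    (hRV : ∀ r : ℝ, 0 < r → Tendsto (fun x => T (r * x) / T x) atTop (𝓝 r⁻¹))
    {r : ℝ} (hr : 0 < r) :
    Tendsto (fun z => averageTail T (r * z) / averageTail T z) atTop (𝓝 r⁻¹) := by
  have h0 := tendsto_div_averageTail hT hpos hb hRV
  set m := min r 1
  have hm : 0 < m := by positivity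
  have h1 : Tendsto (fun z => |r - 1| * (T (m * z) / T z * (T z / averageTail T z))) atTop
      (𝓝 0) := by
    simpa using ((hRV m hm).mul h0).const_mul |r - 1|
  have h2 : Tendsto (fun z => r * (averageTail T (r * z) / averageTail T z) - 1) atTop (𝓝 0) := by
    refine squeeze_zero_norm' ?_ h1
    filter_upwards [eventually_gt_atTop 0] with z hz
    have hA := averageTail_pos hT hpos hb z
    have hTz := hpos z
    have e1 : r * (averageTail T (r * z) / averageTail T z) - 1 =
        ((r * z) * averageTail T (r * z) - z * averageTail T z) / (z * averageTail T z) := by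
      field_simp
    have e2 : |r - 1| * (T (m * z) / T z * (T z / averageTail T z)) =
        (|r - 1| * z * T (m * z)) / (z * averageTail T z) := by
      field_simp
    rw [e1, e2, Real.norm_eq_abs, abs_div, abs_of_pos (mul_pos hz hA), mul_averageTail,
      mul_averageTail]
    refine div_le_div_of_nonneg_right ?_ ?_
    · rcases le_total r 1 with h | h
      · have hle : r * z ≤ z := by nlinarith
        have hu := integral_sub_integral_le_of_antitone hT hle
        have hl := le_integral_sub_integral_of_antitone hT hle
        have : 0 ≤ (z - r * z) * T z := mul_nonneg (by linarith) hTz.le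
        rw [abs_of_nonpos (by linarith), abs_of_nonpos (by linarith), show m = r from min_eq_left h]
        linarith
      · have hle : z ≤ r * z := by nlinarith
        have hu := integral_sub_integral_le_of_antitone hT hle
        have hl := le_integral_sub_integral_of_antitone hT hle
        have : 0 ≤ (r * z - z) * T (r * z) := mul_nonneg (by linarith) (hpos _).le
        rw [abs_of_nonneg (by linarith), abs_of_nonneg (by linarith),
          show m = 1 from min_eq_right h, one_mul]
        linarith
    · rw [← mul_averageTail]; positivity
  have h3 : Tendsto (fun z => r⁻¹ * (r * (averageTail T (r * z) / averageTail T z) - 1 + 1)) atTop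
      (𝓝 (r⁻¹ * (0 + 1))) := (h2.add_const 1).const_mul _
  simpa [hr.ne', inv_mul_cancel_left₀ hr.ne'] using h3

end Average

section LayerCake

variable {Ω : Type*} [MeasurableSpace Ω] {μ : Measure Ω} [IsProbabilityMeasure μ] {X : Ω → ℝ}

/-- Layer-cake formula for a function with signed derivative. -/
lemma integral_comp_div_eq_integral_deriv_mul_tail (hX : Measurable X) (hX0 : ∀ ω, 0 ≤ X ω)
    {k k' : ℝ → ℝ} (hk0 : k 0 = 0) (hk : ContinuousOn k (Set.Ici 0))
    (hk' : ∀ x > 0, HasDerivAt k (k' x) x) (hInt : IntegrableOn k' (Set.Ioi 0))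
    {z : ℝ} (hz : 0 < z) :
    ∫ ω, k (X ω / z) ∂μ = ∫ x in Set.Ioi 0, k' x * μ.real {ω | z * x < X ω} := by
  have hrep : ∀ y, 0 ≤ y → k y = ∫ x in Set.Ioi 0, (Set.Iio y).indicator k' x := by
    intro y hy
    rw [setIntegral_indicator measurableSet_Iio, Set.Ioi_inter_Iio,
      ← integral_Ioc_eq_integral_Ioo, ← intervalIntegral.integral_of_le hy,
      intervalIntegral.integral_eq_sub_of_hasDerivAt_of_le hy (hk.mono Set.Icc_subset_Ici_self)
        (fun x hx => hk' x hx.1), hk0, sub_zero]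
    rw [intervalIntegrable_iff_integrableOn_Ioc_of_le hy]
    exact hInt.mono_set Set.Ioc_subset_Ioi_self
  set S : Set (Ω × ℝ) := {p | z * p.2 < X p.1} with hS
  have hSm : MeasurableSet S :=
    measurableSet_lt (measurable_snd.const_mul z) (hX.comp measurable_fst)
  have hprod : Integrable (S.indicator fun p => k' p.2) (μ.prod (volume.restrict (Set.Ioi 0))) :=
    (Integrable.comp_snd hInt μ).indicator hSm
  have e1 : ∀ ω, k (X ω / z) = ∫ x in Set.Ioi 0, S.indicator (fun p => k' p.2) (ω, x) := by
    intro ω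
    rw [hrep _ (div_nonneg (hX0 ω) hz.le)]
    congr 1
    ext x
    simp only [Set.indicator, Set.mem_Iio, hS, Set.mem_ofPred_eq, lt_div_iff₀ hz, mul_comm x z]
  simp_rw [e1]
  rw [integral_integral_swap (f := fun ω x => S.indicator (fun p => k' p.2) (ω, x)) hprod]
  refine integral_congr_ae (Eventually.of_forall fun x => ?_)
  have hm : MeasurableSet {ω | z * x < X ω} := measurableSet_lt measurable_const hX
  have : (fun ω => S.indicator (fun p => k' p.2) (ω, x)) =
      {ω | z * x < X ω}.indicator fun _ => k' x := by
    ext ω; simp [Set.indicator, hS]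
  simp only [this, integral_indicator_const _ hm, smul_eq_mul, mul_comm]

lemma one_sub_integral_exp_neg_div (hX : Measurable X) (hX0 : ∀ ω, 0 ≤ X ω) {z : ℝ}
    (hz : 0 < z) :
    1 - ∫ ω, Real.exp (-(X ω / z)) ∂μ =
      ∫ x in Set.Ioi 0, Real.exp (-x) * μ.real {ω | z * x < X ω} := by
  rw [← integral_comp_div_eq_integral_deriv_mul_tail (k := fun x => 1 - Real.exp (-x)) hX hX0
    (by simp) (by fun_prop) (fun x _ => ?_) (integrableOn_exp_neg_Ioi 0) hz]
  · rw [integral_sub (integrable_const _)]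
    · simp
    · refine (integrable_const (1 : ℝ)).mono' (by fun_prop) (Eventually.of_forall fun ω => ?_)
      have := div_nonneg (hX0 ω) hz.le
      simpa using this
  · simpa using ((hasDerivAt_neg x).exp).const_sub 1

end LayerCake

section LaplaceAsymptotics

variable {T : ℝ → ℝ}

lemma integrableOn_mul_comp_mul (hT : Antitone T) (hpos : ∀ x, 0 < T x) (hb : ∀ x, T x ≤ 1)
    {g : ℝ → ℝ} {s : Set ℝ} (hg : IntegrableOn g s) (z : ℝ) :
    IntegrableOn (fun x => g x * T (z * x)) s := by
  refine Integrable.mul_bdd (c := 1) hg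
    (hT.measurable.comp (measurable_const_mul z)).aestronglyMeasurable
    (Eventually.of_forall fun x => ?_)
  simpa [abs_of_pos (hpos _)] using hb _

lemma integral_exp_neg_mul_le (hT : Antitone T) (hpos : ∀ x, 0 < T x) (hb : ∀ x, T x ≤ 1)
    {z : ℝ} (hz : 0 ≤ z) :
    ∫ x in Set.Ioi 0, Real.exp (-x) * T (z * x) ≤ averageTail T z + T z := by
  have hi := integrableOn_mul_comp_mul hT hpos hb (integrableOn_exp_neg_Ioi 0) z
  have hi1 := integrableOn_mul_comp_mul hT hpos hb (integrableOn_exp_neg_Ioi 1) z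
  rw [← Set.Ioc_union_Ioi_eq_Ioi (zero_le_one (α := ℝ)),
    setIntegral_union (Set.Ioc_disjoint_Ioi le_rfl) measurableSet_Ioi
      (hi.mono_set Set.Ioc_subset_Ioi_self) hi1]
  refine add_le_add ?_ ?_
  · rw [averageTail, intervalIntegral.integral_of_le zero_le_one]
    refine setIntegral_mono_on (hi.mono_set Set.Ioc_subset_Ioi_self) ?_ measurableSet_Ioc ?_
    · exact (intervalIntegrable_iff_integrableOn_Ioc_of_le zero_le_one).1
        (intervalIntegrable_comp_mul_of_antitone hT hpos hb z 0 1)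
    · intro x hx
      exact mul_le_of_le_one_left (hpos _).le (Real.exp_le_one_iff.2 (by linarith [hx.1]))
  · calc ∫ x in Set.Ioi 1, Real.exp (-x) * T (z * x) ≤ ∫ x in Set.Ioi 1, Real.exp (-x) * T z := by
          refine setIntegral_mono_on hi1 ((integrableOn_exp_neg_Ioi 1).mul_const _)
            measurableSet_Ioi fun x hx => ?_
          have : z ≤ z * x := le_mul_of_one_le_right hz (le_of_lt hx)
          gcongr
          exact hT this
      _ = Real.exp (-1) * T z := by rw [integral_mul_const, integral_exp_neg_Ioi]
      _ ≤ T z := mul_le_of_le_one_left (hpos _).le (Real.exp_le_one_iff.2 (by norm_num))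

lemma le_integral_exp_neg_mul (hT : Antitone T) (hpos : ∀ x, 0 < T x) (hb : ∀ x, T x ≤ 1)
    {ε : ℝ} (hε : 0 < ε) (z : ℝ) :
    Real.exp (-ε) * (ε * averageTail T (ε * z)) ≤
      ∫ x in Set.Ioi 0, Real.exp (-x) * T (z * x) := by
  have hi := integrableOn_mul_comp_mul hT hpos hb (integrableOn_exp_neg_Ioi 0) z
  have hJ := (intervalIntegrable_iff_integrableOn_Ioc_of_le hε.le).1
        (intervalIntegrable_comp_mul_of_antitone hT hpos hb z 0 ε)
  have e : ε * averageTail T (ε * z) = ∫ x in Set.Ioc 0 ε, T (z * x) := by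
    rw [← intervalIntegral.integral_of_le hε.le, averageTail]
    have := intervalIntegral.mul_integral_comp_mul_left (a := 0) (b := 1) (f := fun x => T (z * x)) ε
    simp only [mul_zero, mul_one] at this
    rw [← this]
    congr 2
    ext x
    congr 1
    ring
  rw [e, ← integral_const_mul]
  refine (setIntegral_mono_on (hJ.const_mul _) (hi.mono_set Set.Ioc_subset_Ioi_self)
    measurableSet_Ioc fun x hx => ?_).trans
    (setIntegral_mono_set hi (Eventually.of_forall fun x => ?_)
      Set.Ioc_subset_Ioi_self.eventuallyLE)
  · have := hpos (z * x)
    gcongr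
    exact hx.2
  · have := hpos (z * x)
    simp only [Pi.zero_apply]
    positivity

lemma tendsto_integral_exp_neg_mul_div (hT : Antitone T) (hpos : ∀ x, 0 < T x)
    (hb : ∀ x, T x ≤ 1)
    (hRV : ∀ r : ℝ, 0 < r → Tendsto (fun x => T (r * x) / T x) atTop (𝓝 r⁻¹)) :
    Tendsto (fun z => (∫ x in Set.Ioi 0, Real.exp (-x) * T (z * x)) / averageTail T z) atTop
      (𝓝 1) := by
  rw [tendsto_order]
  constructor
  · intro b hb1
    have hcont : Tendsto (fun ε : ℝ => Real.exp (-ε)) (𝓝[>] 0) (𝓝 1) := by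
      have : Continuous fun ε : ℝ => Real.exp (-ε) := by fun_prop
      simpa using (this.tendsto 0).mono_left nhdsWithin_le_nhds
    obtain ⟨ε, hε1, hε⟩ := ((hcont.eventually_const_lt hb1).and self_mem_nhdsWithin).exists
    have hε : 0 < ε := hε
    have hlim := ((tendsto_averageTail_mul_div hT hpos hb hRV hε).const_mul ε).const_mul
      (Real.exp (-ε))
    rw [mul_inv_cancel₀ hε.ne', mul_one] at hlim
    filter_upwards [hlim.eventually_const_lt hε1] with z hz
    refine hz.trans_le ?_
    have hA := averageTail_pos hT hpos hb z
    rw [le_div_iff₀ hA]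
    refine le_trans (le_of_eq ?_) (le_integral_exp_neg_mul hT hpos hb hε z)
    field_simp
  · intro b hb1
    have hlim := (tendsto_div_averageTail hT hpos hb hRV).const_add 1
    rw [add_zero] at hlim
    filter_upwards [hlim.eventually_lt_const hb1, eventually_ge_atTop 0] with z hz hz0
    refine lt_of_le_of_lt ?_ hz
    have hA := averageTail_pos hT hpos hb z
    rw [div_le_iff₀ hA, add_mul, div_mul_cancel₀ _ hA.ne', one_mul]
    exact integral_exp_neg_mul_le hT hpos hb hz0

end LaplaceAsymptotics

section GammaKernel

/-- The derivative of `x ^ γ * exp (-x)`. -/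
noncomputable def gammaKernelDeriv (γ x : ℝ) : ℝ :=
  γ * (Real.exp (-x) * x ^ (γ - 1)) - Real.exp (-x) * x ^ γ

lemma integrableOn_exp_neg_mul_rpow {p : ℝ} (hp : -1 < p) :
    IntegrableOn (fun x : ℝ => Real.exp (-x) * x ^ p) (Set.Ioi 0) := by
  simpa using Real.GammaIntegral_convergent (s := p + 1) (by linarith)

lemma setIntegral_exp_neg_mul_rpow {p : ℝ} (hp : -1 < p) :
    ∫ x in Set.Ioi 0, Real.exp (-x) * x ^ p = Real.Gamma (p + 1) := by
  rw [Real.Gamma_eq_integral (by linarith)]; simp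

lemma integrableOn_gammaKernelDeriv {γ : ℝ} (hγ : 0 < γ) :
    IntegrableOn (gammaKernelDeriv γ) (Set.Ioi 0) :=
  ((integrableOn_exp_neg_mul_rpow (by linarith)).const_mul γ).sub
    (integrableOn_exp_neg_mul_rpow (by linarith))

lemma gammaKernelDeriv_mul_rpow (γ p : ℝ) {x : ℝ} (hx : 0 < x) :
    gammaKernelDeriv γ x * x ^ p = gammaKernelDeriv (γ + p) x - p * (Real.exp (-x) * x ^ (γ + p - 1))
    := by
  simp only [gammaKernelDeriv, sub_mul, mul_assoc]
  rw [← Real.rpow_add hx, ← Real.rpow_add hx, show γ - 1 + p = γ + p - 1 by ring]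
  ring

lemma integrableOn_gammaKernelDeriv_mul_rpow {γ p : ℝ} (h : 0 < γ + p) :
    IntegrableOn (fun x => gammaKernelDeriv γ x * x ^ p) (Set.Ioi 0) := by
  refine IntegrableOn.congr_fun ((integrableOn_gammaKernelDeriv h).sub
    ((integrableOn_exp_neg_mul_rpow (p := γ + p - 1) (by linarith)).const_mul p))
    (fun x hx => (gammaKernelDeriv_mul_rpow γ p hx).symm) measurableSet_Ioi

lemma integral_gammaKernelDeriv_mul_inv {γ : ℝ} (hγ : 1 < γ) :
    ∫ x in Set.Ioi 0, gammaKernelDeriv γ x * x⁻¹ = Real.Gamma (γ - 1) := by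
  have e : ∀ x ∈ Set.Ioi (0 : ℝ), gammaKernelDeriv γ x * x⁻¹ =
      γ * (Real.exp (-x) * x ^ (γ - 2)) - Real.exp (-x) * x ^ (γ - 1) := by
    intro x hx
    have hx : 0 < x := hx
    rw [← Real.rpow_neg_one, gammaKernelDeriv, sub_mul, mul_assoc, mul_assoc, mul_assoc,
      ← Real.rpow_add hx, ← Real.rpow_add hx]
    ring_nf
  rw [setIntegral_congr_fun measurableSet_Ioi e, integral_sub, integral_const_mul,
    setIntegral_exp_neg_mul_rpow (by linarith), setIntegral_exp_neg_mul_rpow (by linarith)]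
  · have h1 : γ - 2 + 1 = γ - 1 := by ring
    rw [h1, Real.Gamma_add_one (by linarith)]
    ring
  · exact (integrableOn_exp_neg_mul_rpow (by linarith)).const_mul γ
  · exact integrableOn_exp_neg_mul_rpow (by linarith)

lemma integral_rpow_mul_exp_neg_div {Ω : Type*} [MeasurableSpace Ω] {μ : Measure Ω}
    [IsProbabilityMeasure μ] {X : Ω → ℝ} (hX : Measurable X) (hX0 : ∀ ω, 0 ≤ X ω) {γ : ℝ}
    (hγ : 1 < γ) {z : ℝ} (hz : 0 < z) :
    ∫ ω, (X ω / z) ^ γ * Real.exp (-(X ω / z)) ∂μ =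
      ∫ x in Set.Ioi 0, gammaKernelDeriv γ x * μ.real {ω | z * x < X ω} := by
  refine integral_comp_div_eq_integral_deriv_mul_tail (k := fun x => x ^ γ * Real.exp (-x)) hX hX0
    ?_ ?_ (fun x hx => ?_) (integrableOn_gammaKernelDeriv (by linarith)) hz
  · simp [Real.zero_rpow (by linarith : γ ≠ 0)]
  · exact ((Real.continuous_rpow_const (by linarith)).mul (by fun_prop)).continuousOn
  · refine ((Real.hasDerivAt_rpow_const (p := γ) (Or.inl hx.ne')).mul
      ((hasDerivAt_neg x).exp)).congr_deriv ?_
    rw [gammaKernelDeriv]; ring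

variable {T : ℝ → ℝ}

lemma exists_integral_gammaKernelDeriv_mul_le (hT : Antitone T) (hpos : ∀ x, 0 < T x)
    (hb : ∀ x, T x ≤ 1) (h2 : Tendsto (fun x => T (2 * x) / T x) atTop (𝓝 2⁻¹)) {γ : ℝ}
    (hγ : 1 < γ) :
    ∃ G : ℝ → ℝ, IntegrableOn G (Set.Ioi 0) ∧ ∀ z > 0, ∀ x > 0,
      ‖gammaKernelDeriv γ x * (T (z * x) / T z)‖ ≤ G x := by
  obtain ⟨s, hs1, hsγ⟩ := exists_between hγ
  obtain ⟨C, hC, h⟩ := exists_le_rpow_mul_of_tendsto_half hT hpos hb h2 hs1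
  refine ⟨fun x => C * (‖gammaKernelDeriv γ x‖ + ‖gammaKernelDeriv γ x * x ^ (-s)‖), ?_, ?_⟩
  · exact ((integrableOn_gammaKernelDeriv (by linarith)).norm.add
      (integrableOn_gammaKernelDeriv_mul_rpow (by linarith)).norm).const_mul C
  · intro z hz x hx
    have h1 := h x z hx hz
    have hTz := hpos z
    have hTzx := hpos (z * x)
    beta_reduce
    rw [norm_mul, norm_mul, Real.norm_of_nonneg (Real.rpow_nonneg hx.le (-s)),
      Real.norm_of_nonneg (div_pos hTzx hTz).le]
    calc ‖gammaKernelDeriv γ x‖ * (T (z * x) / T z)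
        ≤ ‖gammaKernelDeriv γ x‖ * (C * (1 + x ^ (-s))) := by
          gcongr
          rwa [div_le_iff₀ hTz]
      _ = _ := by ring

lemma tendsto_integral_gammaKernelDeriv_mul_div (hT : Antitone T) (hpos : ∀ x, 0 < T x)
    (hb : ∀ x, T x ≤ 1)
    (hRV : ∀ r : ℝ, 0 < r → Tendsto (fun x => T (r * x) / T x) atTop (𝓝 r⁻¹)) {γ : ℝ}
    (hγ : 1 < γ) :
    Tendsto (fun z => (∫ x in Set.Ioi 0, gammaKernelDeriv γ x * T (z * x)) / T z) atTop
      (𝓝 (Real.Gamma (γ - 1))) := by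
  obtain ⟨G, hG, hle⟩ := exists_integral_gammaKernelDeriv_mul_le hT hpos hb (hRV 2 two_pos) hγ
  rw [← integral_gammaKernelDeriv_mul_inv hγ]
  simp_rw [← integral_div, mul_div_assoc]
  have hm := (integrableOn_gammaKernelDeriv (γ := γ) (by linarith)).aestronglyMeasurable
  refine tendsto_integral_filter_of_dominated_convergence G ?_ ?_ hG ?_
  · refine Eventually.of_forall fun z => hm.mul ?_
    exact ((hT.measurable.comp (measurable_const_mul z)).div_const _).aestronglyMeasurable
  · filter_upwards [eventually_gt_atTop 0] with z hz
    exact (ae_restrict_iff' measurableSet_Ioi).2 (Eventually.of_forall fun x hx => hle z hz x hx)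
  · refine (ae_restrict_iff' measurableSet_Ioi).2 (Eventually.of_forall fun x hx => ?_)
    simpa [mul_comm] using (hRV x hx).const_mul (gammaKernelDeriv γ x)

lemma exists_integral_gammaKernelDeriv_le (hT : Antitone T) (hpos : ∀ x, 0 < T x)
    (hb : ∀ x, T x ≤ 1) (h2 : Tendsto (fun x => T (2 * x) / T x) atTop (𝓝 2⁻¹)) {γ : ℝ}
    (hγ : 1 < γ) :
    ∃ C > 0, ∀ z > 0, ∫ x in Set.Ioi 0, gammaKernelDeriv γ x * T (z * x) ≤ C * T z := by
  obtain ⟨G, hG, hle⟩ := exists_integral_gammaKernelDeriv_mul_le hT hpos hb h2 hγ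
  refine ⟨|∫ x in Set.Ioi 0, G x| + 1, by positivity, fun z hz => ?_⟩
  rw [← div_le_iff₀ (hpos z), ← integral_div]
  simp_rw [mul_div_assoc]
  refine (le_abs_self _).trans ?_
  rw [← Real.norm_eq_abs]
  refine (norm_integral_le_of_norm_le hG ?_).trans (by linarith [le_abs_self (∫ x in Set.Ioi 0, G x)])
  exact (ae_restrict_iff' measurableSet_Ioi).2 (Eventually.of_forall fun x hx => hle z hz x hx)

end GammaKernel

section Identity

variable {Ω : Type*} [MeasurableSpace Ω] {μ : Measure Ω} {X : ℕ → Ω → ℝ}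

lemma integral_rpow_mul_exp_neg_sum (hX : ∀ i, Measurable (X i)) (hindep : iIndepFun X μ)
    (hident : ∀ i, IdentDistrib (X i) (X 0) μ μ) (γ z : ℝ) (m : ℕ) :
    ∫ ω, (X 0 ω / z) ^ γ * Real.exp (-((∑ k ∈ Finset.range (m + 1), X k ω) / z)) ∂μ =
      (∫ ω, (X 0 ω / z) ^ γ * Real.exp (-(X 0 ω / z)) ∂μ) *
        (∫ ω, Real.exp (-(X 0 ω / z)) ∂μ) ^ m := by
  set f : Fin (m + 1) → ℝ → ℝ :=
    Fin.cons (fun x => (x / z) ^ γ * Real.exp (-(x / z))) fun _ x => Real.exp (-(x / z)) with hf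
  have hfm : ∀ i, Measurable (f i) := by
    intro i
    refine Fin.cases ?_ (fun j => ?_) i
    · simp only [hf, Fin.cons_zero]; fun_prop
    · simp only [hf, Fin.cons_succ]; fun_prop
  have hind : iIndepFun (fun i : Fin (m + 1) => X i) μ := hindep.precomp Fin.val_injective
  have h := hind.integral_fun_prod_comp (f := f) (fun i => (hX i).aemeasurable)
    fun i => (hfm i).aestronglyMeasurable
  have e1 : ∀ ω, ∏ i, f i (X i ω) =
      (X 0 ω / z) ^ γ * Real.exp (-((∑ k ∈ Finset.range (m + 1), X k ω) / z)) := by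
    intro ω
    rw [Fin.prod_univ_succ, ← Fin.sum_univ_eq_sum_range (fun k => X k ω), Fin.sum_univ_succ]
    simp only [hf, Fin.cons_zero, Fin.cons_succ, ← Real.exp_sum, mul_assoc, ← Real.exp_add]
    congr 2
    rw [add_div, neg_add, Finset.sum_div, Finset.sum_neg_distrib]
  have e2 : ∀ j : Fin m, ∫ ω, Real.exp (-(X (j.succ : ℕ) ω / z)) ∂μ =
      ∫ ω, Real.exp (-(X 0 ω / z)) ∂μ := fun j =>
    ((hident j.succ).comp (u := fun x => Real.exp (-(x / z))) (by fun_prop)).integral_eq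
  simp_rw [e1] at h
  rw [h, Fin.prod_univ_succ]
  simp only [hf, Fin.cons_zero, Fin.cons_succ, e2]
  simp

/-- Gamma-integral representation of the moments of the self-normalised summand. -/
lemma integrableOn_and_integral_div_sum_rpow [IsProbabilityMeasure μ] (hX : ∀ i, Measurable (X i))
    (hX0 : ∀ i ω, 0 ≤ X i ω) (hindep : iIndepFun X μ)
    (hident : ∀ i, IdentDistrib (X i) (X 0) μ μ) {γ : ℝ} (hγ : 1 < γ) (m : ℕ) :
    IntegrableOn (fun t => t⁻¹ * (∫ ω, (X 0 ω / t⁻¹) ^ γ * Real.exp (-(X 0 ω / t⁻¹)) ∂μ) *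
        (∫ ω, Real.exp (-(X 0 ω / t⁻¹)) ∂μ) ^ m) (Set.Ioi 0) ∧
    ∫ t in Set.Ioi 0, t⁻¹ * (∫ ω, (X 0 ω / t⁻¹) ^ γ * Real.exp (-(X 0 ω / t⁻¹)) ∂μ) *
        (∫ ω, Real.exp (-(X 0 ω / t⁻¹)) ∂μ) ^ m =
      Real.Gamma γ * ∫ ω, (X 0 ω / ∑ k ∈ Finset.range (m + 1), X k ω) ^ γ ∂μ := by
  set S : Ω → ℝ := fun ω => ∑ k ∈ Finset.range (m + 1), X k ω with hS
  have hSm : Measurable S := Finset.measurable_sum _ fun i _ => hX i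
  have hXS : ∀ ω, X 0 ω ≤ S ω := fun ω =>
    Finset.single_le_sum (f := fun k => X k ω) (fun i _ => hX0 i ω) (by simp)
  have hS0 : ∀ ω, 0 ≤ S ω := fun ω => (hX0 0 ω).trans (hXS ω)
  have hγ0 : 0 < γ := by linarith
  have hΓ := Real.Gamma_pos_of_pos hγ0
  set F : Ω × ℝ → ℝ := fun p => X 0 p.1 ^ γ * (p.2 ^ (γ - 1) * Real.exp (-(S p.1 * p.2))) with hF
  have hFm : Measurable F := by
    have h0 := hX 0
    simp only [hF]
    fun_prop
  have hgam : ∀ ω, IntegrableOn (fun t => F (ω, t)) (Set.Ioi 0) ∧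
      ∫ t in Set.Ioi 0, F (ω, t) = Real.Gamma γ * (X 0 ω / S ω) ^ γ := by
    intro ω
    rcases (hS0 ω).eq_or_lt with h | h
    · have : X 0 ω = 0 := le_antisymm (h ▸ hXS ω) (hX0 0 ω)
      simp [hF, this, Real.zero_rpow hγ0.ne']
    · have hi := Real.integral_rpow_mul_exp_neg_mul_Ioi hγ0 h
      constructor
      · have hi' : IntegrableOn (fun t : ℝ => t ^ (γ - 1) * Real.exp (-(S ω * t))) (Set.Ioi 0) :=
          .of_integral_ne_zero (by rw [hi]; positivity)
        exact hi'.const_mul (X 0 ω ^ γ)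
      · simp only [hF]
        rw [integral_const_mul, hi, Real.div_rpow (hX0 0 ω) h.le, one_div, Real.inv_rpow h.le]
        ring
  have hF0 : ∀ ω, ∀ t ∈ Set.Ioi (0 : ℝ), 0 ≤ F (ω, t) := by
    intro ω t ht
    have ht : 0 < t := ht
    have := hX0 0 ω
    simp only [hF]; positivity
  have hratio : Integrable (fun ω => Real.Gamma γ * (X 0 ω / S ω) ^ γ) μ := by
    refine Integrable.const_mul ((integrable_const (1 : ℝ)).mono' ?_
      (Eventually.of_forall fun ω => ?_)) _
    · exact (((hX 0).div hSm).pow_const γ).aestronglyMeasurable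
    · have h0 : 0 ≤ X 0 ω / S ω := div_nonneg (hX0 0 ω) (hS0 ω)
      rw [Real.norm_of_nonneg (by positivity)]
      exact Real.rpow_le_one h0 (div_le_one_of_le₀ (hXS ω) (hS0 ω)) hγ0.le
  have hFint : Integrable F (μ.prod (volume.restrict (Set.Ioi 0))) := by
    rw [integrable_prod_iff hFm.aestronglyMeasurable]
    refine ⟨Eventually.of_forall fun ω => (hgam ω).1, hratio.congr (Eventually.of_forall fun ω => ?_)⟩
    beta_reduce
    rw [← (hgam ω).2]
    exact setIntegral_congr_fun measurableSet_Ioi fun t ht => (Real.norm_of_nonneg (hF0 ω t ht)).symm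
  have hinner : ∀ t ∈ Set.Ioi (0 : ℝ), ∫ ω, F (ω, t) ∂μ =
      t⁻¹ * (∫ ω, (X 0 ω / t⁻¹) ^ γ * Real.exp (-(X 0 ω / t⁻¹)) ∂μ) *
        (∫ ω, Real.exp (-(X 0 ω / t⁻¹)) ∂μ) ^ m := by
    intro t ht
    have ht : 0 < t := ht
    rw [mul_assoc, ← integral_rpow_mul_exp_neg_sum hX hindep hident, ← integral_const_mul]
    refine integral_congr_ae (Eventually.of_forall fun ω => ?_)
    simp only [hF, div_inv_eq_mul]
    rw [Real.mul_rpow (hX0 0 ω) ht.le, Real.rpow_sub ht, Real.rpow_one]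
    ring
  constructor
  · exact IntegrableOn.congr_fun hFint.integral_prod_right hinner measurableSet_Ioi
  · rw [← setIntegral_congr_fun measurableSet_Ioi hinner,
      ← integral_integral_swap (f := fun ω t => F (ω, t)) hFint, ← integral_const_mul]
    exact integral_congr_ae (Eventually.of_forall fun ω => (hgam ω).2)

end Identity

section LaplaceMethod

variable {T : ℝ → ℝ} {a : ℕ → ℝ}

/-- A norming sequence makes `1 / T (a n)` grow at most polynomially. -/
lemma exists_inv_le_polynomial (hT : Antitone T) (hpos : ∀ x, 0 < T x) (hb : ∀ x, T x ≤ 1)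
    (hRV : ∀ r : ℝ, 0 < r → Tendsto (fun x => T (r * x) / T x) atTop (𝓝 r⁻¹))
    (ha : Tendsto a atTop atTop)
    (hna : Tendsto (fun n : ℕ => n * averageTail T (a n)) atTop (𝓝 1)) :
    ∃ C : ℝ, ∀ᶠ n : ℕ in atTop, (T (a n))⁻¹ ≤ C * (1 + (n : ℝ) ^ 4) := by
  obtain ⟨C₁, hC₁, hup⟩ := exists_le_rpow_mul_of_tendsto_half hT hpos hb (hRV 2 two_pos)
    (one_lt_two)
  have hA := averageTail_pos hT hpos hb
  obtain ⟨x₀, hx₀, hlow⟩ := exists_rpow_mul_le_of_tendsto_half (averageTail_antitone hT hpos hb) hA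
    (tendsto_averageTail_mul_div hT hpos hb hRV two_pos) (s := 1 / 2) (by norm_num) (by norm_num)
  set B := (2 : ℝ) ^ (1 / 2 : ℝ) * averageTail T x₀
  set D := x₀ * (2 * B) ^ 2
  have hT1 := hpos 1
  refine ⟨C₁ / T 1 * (1 + D ^ 2), ?_⟩
  filter_upwards [ha.eventually_ge_atTop x₀, hna.eventually_const_lt (show (1 / 2 : ℝ) < 1 by norm_num)]
    with n h1 h2
  have han : 0 < a n := hx₀.trans_le h1
  have h3 := hlow x₀ (a n) le_rfl h1
  have hAn := hA (a n)
  have h4 : (a n / x₀) ^ (1 / 2 : ℝ) ≤ 2 * B * n := by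
    have h5 : 0 ≤ (a n / x₀) ^ (1 / 2 : ℝ) := by positivity
    have h6 : (a n / x₀) ^ (1 / 2 : ℝ) * (1 / 2) ≤
        (a n / x₀) ^ (1 / 2 : ℝ) * (n * averageTail T (a n)) := by gcongr
    have h7 : (n : ℝ) * ((a n / x₀) ^ (1 / 2 : ℝ) * averageTail T (a n)) ≤ n * B := by gcongr
    linarith
  have h8 : a n ≤ D * n ^ 2 := by
    have h9 : a n / x₀ = ((a n / x₀) ^ (1 / 2 : ℝ)) ^ 2 := by
      rw [← Real.sqrt_eq_rpow, Real.sq_sqrt (by positivity)]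
    have h10 : a n / x₀ ≤ (2 * B * n) ^ 2 := by
      rw [h9]; gcongr
    rw [div_le_iff₀ hx₀] at h10
    calc a n ≤ _ := h10
      _ = _ := by simp only [D]; ring
  have h11 := hup (a n)⁻¹ (a n) (by positivity) han
  rw [mul_inv_cancel₀ han.ne', Real.rpow_neg (by positivity), Real.inv_rpow han.le, inv_inv] at h11
  have hTn := hpos (a n)
  calc (T (a n))⁻¹ ≤ C₁ / T 1 * (1 + a n ^ (2 : ℝ)) := by
        rw [inv_le_iff_one_le_mul₀ hTn, div_mul_eq_mul_div, div_mul_eq_mul_div, one_le_div hT1]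
        exact h11
    _ ≤ C₁ / T 1 * ((1 + D ^ 2) * (1 + (n : ℝ) ^ 4)) := by
        gcongr
        rw [Real.rpow_two]
        have : a n ^ 2 ≤ (D * n ^ 2) ^ 2 := by gcongr
        have h12 : 0 ≤ D ^ 2 := by positivity
        have h13 : 0 ≤ (n : ℝ) ^ 4 := by positivity
        nlinarith
    _ = _ := by ring

/-- Laplace's method for `∫ H(1/t) Φ(1/t)^(n-1) dt/t`, where `H` is comparable to `T` and
`1 - Φ` to the average of `T`. -/
lemma tendsto_integral_inv_mul_pow_div (hT : Antitone T) (hpos : ∀ x, 0 < T x)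
    (hb : ∀ x, T x ≤ 1)
    (hRV : ∀ r : ℝ, 0 < r → Tendsto (fun x => T (r * x) / T x) atTop (𝓝 r⁻¹))
    (ha : Tendsto a atTop atTop)
    (hna : Tendsto (fun n : ℕ => n * averageTail T (a n)) atTop (𝓝 1))
    {H Φ : ℝ → ℝ} {G C : ℝ} (hH0 : ∀ z > 0, 0 ≤ H z) (hHC : ∀ z > 0, H z ≤ C * T z)
    (hHlim : Tendsto (fun z => H z / T z) atTop (𝓝 G))
    (hInt : ∀ m : ℕ, IntegrableOn (fun t => t⁻¹ * H t⁻¹ * Φ t⁻¹ ^ m) (Set.Ioi 0))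
    (hΦ0 : ∀ z > 0, 0 ≤ Φ z) (hΦmono : MonotoneOn Φ (Set.Ioi 0))
    (hΦle : ∀ z > 0, Real.exp (-1) * averageTail T z ≤ 1 - Φ z)
    (hΦlim : Tendsto (fun z => (1 - Φ z) / averageTail T z) atTop (𝓝 1)) :
    Tendsto (fun n : ℕ => (∫ t in Set.Ioi 0, t⁻¹ * H t⁻¹ * Φ t⁻¹ ^ (n - 1)) / T (a n)) atTop
      (𝓝 G) := by
  have hA := averageTail_pos hT hpos hb
  obtain ⟨x₀, hx₀, hlowA⟩ := exists_rpow_mul_le_of_tendsto_half (averageTail_antitone hT hpos hb) hA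
    (tendsto_averageTail_mul_div hT hpos hb hRV two_pos) (s := 1 / 2) (by norm_num) (by norm_num)
  obtain ⟨x₁, hx₁, hlowT⟩ := exists_rpow_mul_le_of_tendsto_half hT hpos (hRV 2 two_pos)
    (s := 1 / 2) (by norm_num) (by norm_num)
  obtain ⟨C₁, hC₁, hup⟩ := exists_le_rpow_mul_of_tendsto_half hT hpos hb (hRV 2 two_pos)
    (one_lt_two)
  have hC : 0 ≤ C := by
    have h1 := (hH0 1 one_pos).trans (hHC 1 one_pos)
    exact nonneg_of_mul_nonneg_left h1 (hpos 1)
  have hΦ1 : ∀ z > 0, Φ z ≤ 1 := fun z hz => by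
    have := hΦle z hz
    have := hA z
    have : 0 < Real.exp (-1) * averageTail T z := by positivity
    linarith
  set κ : ℝ := (2 : ℝ) ^ (1 / 2 : ℝ)
  have hκ : 0 < κ := by positivity
  set q : ℕ → ℝ → ℝ := fun n t => t⁻¹ * H t⁻¹ * Φ t⁻¹ ^ (n - 1) with hq
  have hq0 : ∀ n, ∀ t > 0, 0 ≤ q n t := fun n t ht => by
    have h1 := hH0 t⁻¹ (by positivity)
    have h2 := hΦ0 t⁻¹ (by positivity)
    simp only [hq]; positivity
  have hqi : ∀ n, IntegrableOn (q n) (Set.Ioi 0) := fun n => hInt (n - 1)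
  -- the contribution of large `t`
  have hrem : Tendsto (fun n => (∫ t in Set.Ioi x₀⁻¹, q n t) / T (a n)) atTop (𝓝 0) := by
    obtain ⟨D, hD⟩ := exists_inv_le_polynomial hT hpos hb hRV ha hna
    have hx0inv : 0 ≤ x₀⁻¹ := by positivity
    have hsub : Set.Ioi x₀⁻¹ ⊆ Set.Ioi 0 := Set.Ioi_subset_Ioi hx0inv
    set ρ := max (Φ x₀) (1 / 2)
    have hρ0 : 0 < ρ := by positivity
    have hρ1 : ρ < 1 := by
      refine max_lt ?_ (by norm_num)
      have := hΦle x₀ hx₀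
      have := hA x₀
      have : 0 < Real.exp (-1) * averageTail T x₀ := by positivity
      linarith
    set K := ∫ t in Set.Ioi x₀⁻¹, t⁻¹ * H t⁻¹ with hK
    have hi0 : IntegrableOn (fun t => t⁻¹ * H t⁻¹) (Set.Ioi x₀⁻¹) := by
      simpa using (hInt 0).mono_set hsub
    have hle : ∀ n, ∫ t in Set.Ioi x₀⁻¹, q n t ≤ ρ ^ (n - 1) * K := by
      intro n
      rw [hK, ← integral_const_mul]
      refine setIntegral_mono_on ((hqi n).mono_set hsub) (hi0.const_mul _) measurableSet_Ioi ?_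
      intro t ht
      have ht0 : 0 < t := hsub ht
      have h1 := hH0 t⁻¹ (by positivity)
      have h2 := hΦ0 t⁻¹ (by positivity)
      have h3 : Φ t⁻¹ ≤ ρ := (hΦmono (Set.mem_Ioi.2 (by positivity)) hx₀
        (inv_le_of_inv_le₀ hx₀ (le_of_lt ht))).trans (le_max_left _ _)
      simp only [hq]
      rw [mul_comm (ρ ^ (n - 1))]
      gcongr
    have hK0 : 0 ≤ K := setIntegral_nonneg measurableSet_Ioi fun t ht => by
      have ht0 : 0 < t := hsub ht
      have h1 := hH0 t⁻¹ (by positivity)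
      positivity
    have hlim : Tendsto (fun n : ℕ => ρ⁻¹ * K * D * (ρ ^ n + (n : ℝ) ^ 4 * ρ ^ n)) atTop (𝓝 0) := by
      have h1 := tendsto_pow_atTop_nhds_zero_of_lt_one hρ0.le hρ1
      have h2 := tendsto_pow_const_mul_const_pow_of_abs_lt_one 4
        (show |ρ| < 1 by rwa [abs_of_pos hρ0])
      simpa using (h1.add h2).const_mul (ρ⁻¹ * K * D)
    refine squeeze_zero' (Eventually.of_forall fun n => ?_) ?_ hlim
    · exact div_nonneg (setIntegral_nonneg measurableSet_Ioi fun t ht => hq0 n t (hsub ht))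
        (hpos _).le
    · filter_upwards [hD, eventually_ge_atTop 1] with n hn hn1
      have hTn := hpos (a n)
      rw [div_eq_mul_inv]
      calc (∫ t in Set.Ioi x₀⁻¹, q n t) * (T (a n))⁻¹
          ≤ (ρ ^ (n - 1) * K) * (D * (1 + (n : ℝ) ^ 4)) := by
            gcongr
            exact hle n
        _ = _ := by
            rw [pow_sub₀ _ hρ0.ne' hn1]; ring
  -- the main contribution, after rescaling
  set p : ℕ → ℝ → ℝ := fun n => (Set.Iic (a n / x₀)).indicator
    fun u => u⁻¹ * (H (a n / u) / T (a n)) * Φ (a n / u) ^ (n - 1) with hp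
  have hscale : ∀ n, 0 < a n → ∀ u, (a n)⁻¹ * ((Set.Iic x₀⁻¹).indicator (q n) ((a n)⁻¹ * u)) / T (a n)
      = p n u := by
    intro n hn u
    have hiff : (a n)⁻¹ * u ∈ Set.Iic x₀⁻¹ ↔ u ∈ Set.Iic (a n / x₀) := by
      simp only [Set.mem_Iic]
      rw [← div_eq_inv_mul, div_le_iff₀ hn, div_eq_inv_mul]
    by_cases hu : u ∈ Set.Iic (a n / x₀)
    · simp only [hp]
      rw [Set.indicator_of_mem hu, Set.indicator_of_mem (hiff.2 hu)]
      simp only [hq, mul_inv, inv_inv, ← div_eq_mul_inv]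
      field_simp
    · simp only [hp]
      rw [Set.indicator_of_notMem hu, Set.indicator_of_notMem (fun h => hu (hiff.1 h))]
      simp
  have hmaineq : ∀ n, 0 < a n →
      (∫ t in Set.Ioc 0 x₀⁻¹, q n t) / T (a n) = ∫ u in Set.Ioi 0, p n u := by
    intro n hn
    have hn' : 0 < (a n)⁻¹ := by positivity
    rw [← Set.Ioi_inter_Iic, ← setIntegral_indicator measurableSet_Iic]
    have h := integral_comp_mul_left_Ioi' ((Set.Iic x₀⁻¹).indicator (q n)) 0 hn'
    rw [mul_zero] at h
    rw [← h, smul_eq_mul, ← integral_const_mul, ← integral_div]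
    simp only [hscale n hn]
  have hpint : ∀ n, 0 < a n → IntegrableOn (p n) (Set.Ioi 0) := by
    intro n hn
    have hn' : 0 < (a n)⁻¹ := by positivity
    have h1 : IntegrableOn ((Set.Iic x₀⁻¹).indicator (q n)) (Set.Ioi ((a n)⁻¹ * 0)) := by
      rw [mul_zero]
      exact (hqi n).indicator measurableSet_Iic
    rw [← integrableOn_Ioi_comp_mul_left_iff _ _ hn'] at h1
    have h2 : IntegrableOn (fun u => (a n)⁻¹ * ((Set.Iic x₀⁻¹).indicator (q n) ((a n)⁻¹ * u)) / T (a n))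
      (Set.Ioi 0) := (h1.const_mul _).div_const _
    simpa only [hscale n hn] using h2
  set c : ℝ := Real.exp (-1) / (2 * κ)
  have hc : 0 < c := by positivity
  set bound : ℝ → ℝ := fun u => (C * (κ + C₁)) * Real.exp c *
    (u ^ (-(1 / 2) : ℝ) * Real.exp (-c * u ^ (1 / 2 : ℝ)) +
      u ^ (2 : ℝ) * Real.exp (-c * u ^ (1 / 2 : ℝ))) with hbound
  have hbi : IntegrableOn bound (Set.Ioi 0) :=
    ((integrableOn_rpow_mul_exp_neg_mul_rpow (by norm_num) (by norm_num) hc).add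
      (integrableOn_rpow_mul_exp_neg_mul_rpow (by norm_num) (by norm_num) hc)).const_mul _
  have hΦbound : ∀ᶠ n in atTop, ∀ u > 0, u ≤ a n / x₀ →
      Φ (a n / u) ^ (n - 1) ≤ Real.exp c * Real.exp (-c * u ^ (1 / 2 : ℝ)) := by
    have hinv : Tendsto (fun n => averageTail T (a n)) atTop (𝓝 0) := by
      have := hna.mul tendsto_inv_atTop_nhds_zero_nat
      rw [mul_zero] at this
      refine this.congr' ?_
      filter_upwards [eventually_gt_atTop 0] with n hn
      have : (n : ℝ) ≠ 0 := by positivity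
      field_simp
    have hlim := hna.sub hinv
    rw [sub_zero] at hlim
    filter_upwards [hlim.eventually_const_lt (show (1 / 2 : ℝ) < 1 by norm_num),
      ha.eventually_gt_atTop 0, eventually_ge_atTop 1] with n h1 han hn1 u hu hua
    have hz : 0 < a n / u := by positivity
    rw [← Real.exp_add]
    rcases le_or_gt u 1 with hu1 | hu1
    · refine (pow_le_one₀ (hΦ0 _ hz) (hΦ1 _ hz)).trans (Real.one_le_exp ?_)
      have : u ^ (1 / 2 : ℝ) ≤ 1 := Real.rpow_le_one hu.le hu1 (by norm_num)
      nlinarith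
    · have h2 : x₀ ≤ a n / u := by
        rw [le_div_iff₀ hx₀] at hua
        rwa [le_div_iff₀ hu, mul_comm]
      have h3 := hlowA (a n / u) (a n) h2 (div_le_self han.le hu1.le)
      rw [show a n / (a n / u) = u by field_simp] at h3
      have h4 := hΦle _ hz
      have h5 : Φ (a n / u) ≤ Real.exp (-(1 - Φ (a n / u))) := by
        have := Real.add_one_le_exp (-(1 - Φ (a n / u)))
        linarith
      have h6 : ((n - 1 : ℕ) : ℝ) = n - 1 := by
        rw [Nat.cast_sub hn1, Nat.cast_one]
      calc Φ (a n / u) ^ (n - 1) ≤ Real.exp (-(1 - Φ (a n / u))) ^ (n - 1) := by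
            gcongr
            exact hΦ0 _ hz
        _ = Real.exp (((n : ℝ) - 1) * (-(1 - Φ (a n / u)))) := by
            rw [← Real.exp_nat_mul, h6]
        _ ≤ Real.exp (c + -c * u ^ (1 / 2 : ℝ)) := by
            have h7 : (0 : ℝ) ≤ n - 1 := by
              rw [← h6]; positivity
            have h8 : 0 ≤ u ^ (1 / 2 : ℝ) := by positivity
            have h9 : c * u ^ (1 / 2 : ℝ) ≤ ((n : ℝ) - 1) * (1 - Φ (a n / u)) := by
              calc c * u ^ (1 / 2 : ℝ) = Real.exp (-1) / κ * (1 / 2) * u ^ (1 / 2 : ℝ) := by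
                    simp only [c]; field_simp
                _ ≤ Real.exp (-1) / κ * (n * averageTail T (a n) - averageTail T (a n))
                      * u ^ (1 / 2 : ℝ) := by gcongr
                _ = ((n : ℝ) - 1) * (Real.exp (-1) / κ *
                      (u ^ (1 / 2 : ℝ) * averageTail T (a n))) := by ring
                _ ≤ ((n : ℝ) - 1) * (Real.exp (-1) / κ * (κ * averageTail T (a n / u))) := by
                      gcongr
                _ = ((n : ℝ) - 1) * (Real.exp (-1) * averageTail T (a n / u)) := by
                      field_simp
                _ ≤ _ := by gcongr
            apply Real.exp_le_exp.2
            linarith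
  have hHbound : ∀ᶠ n in atTop, ∀ u > 0, u⁻¹ * (H (a n / u) / T (a n)) ≤
      C * (κ + C₁) * (u ^ (-(1 / 2) : ℝ) + u ^ (2 : ℝ)) := by
    filter_upwards [ha.eventually_ge_atTop x₁] with n hn u hu
    have han : 0 < a n := hx₁.trans_le hn
    have hz : 0 < a n / u := by positivity
    have hTn := hpos (a n)
    have h1 := hHC _ hz
    have hu2 : 0 < u ^ (2 : ℝ) := by positivity
    have hu3 : 0 < u ^ (-(1 / 2) : ℝ) := by positivity
    have key : u⁻¹ * (T (a n / u) / T (a n)) ≤ (κ + C₁) * (u ^ (-(1 / 2) : ℝ) + u ^ (2 : ℝ)) := by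
      rcases le_or_gt u 1 with hu1 | hu1
      · have h2 := hlowT (a n) (a n / u) hn (le_div_self han.le hu hu1)
        rw [show a n / u / a n = u⁻¹ by field_simp, Real.inv_rpow hu.le] at h2
        have h3 : T (a n / u) / T (a n) ≤ κ * u ^ (1 / 2 : ℝ) := by
          rw [div_le_iff₀ hTn]
          rw [inv_mul_le_iff₀ (by positivity)] at h2
          linarith
        calc u⁻¹ * (T (a n / u) / T (a n)) ≤ u⁻¹ * (κ * u ^ (1 / 2 : ℝ)) := by gcongr
          _ = κ * u ^ (-(1 / 2) : ℝ) := by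
            rw [← Real.rpow_neg_one, mul_left_comm, ← Real.rpow_add hu]; norm_num
          _ ≤ _ := by gcongr <;> linarith
      · have h2 := hup u⁻¹ (a n) (by positivity) han
        rw [Real.rpow_neg (by positivity), Real.inv_rpow hu.le, inv_inv, ← div_eq_mul_inv] at h2
        have h3 : T (a n / u) / T (a n) ≤ C₁ * (1 + u ^ (2 : ℝ)) := by
          rwa [div_le_iff₀ hTn]
        have h4 : u⁻¹ ≤ u ^ (-(1 / 2) : ℝ) := by
          rw [← Real.rpow_neg_one]
          exact Real.rpow_le_rpow_of_exponent_le hu1.le (by norm_num)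
        have h5 : u⁻¹ ≤ 1 := inv_le_one_of_one_le₀ hu1.le
        calc u⁻¹ * (T (a n / u) / T (a n)) ≤ u⁻¹ * (C₁ * (1 + u ^ (2 : ℝ))) := by gcongr
          _ = C₁ * (u⁻¹ + u⁻¹ * u ^ (2 : ℝ)) := by ring
          _ ≤ C₁ * (u ^ (-(1 / 2) : ℝ) + 1 * u ^ (2 : ℝ)) := by gcongr
          _ ≤ _ := by
            rw [one_mul]
            gcongr
            linarith
    calc u⁻¹ * (H (a n / u) / T (a n)) ≤ u⁻¹ * (C * T (a n / u) / T (a n)) := by gcongr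
      _ = C * (u⁻¹ * (T (a n / u) / T (a n))) := by ring
      _ ≤ _ := by
        rw [mul_assoc]
        gcongr
  have hmain : Tendsto (fun n => ∫ u in Set.Ioi 0, p n u) atTop
      (𝓝 (∫ u in Set.Ioi 0, G * Real.exp (-u))) := by
    refine tendsto_integral_filter_of_dominated_convergence bound ?_ ?_ hbi ?_
    · filter_upwards [ha.eventually_gt_atTop 0] with n hn
      exact (hpint n hn).aestronglyMeasurable
    · filter_upwards [ha.eventually_gt_atTop 0, hΦbound, hHbound] with n hn h1 h2
      refine (ae_restrict_iff' measurableSet_Ioi).2 (Eventually.of_forall fun u hu => ?_)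
      have hu : 0 < u := hu
      have hbu : bound u = C * (κ + C₁) * (u ^ (-(1 / 2) : ℝ) + u ^ (2 : ℝ)) *
          (Real.exp c * Real.exp (-c * u ^ (1 / 2 : ℝ))) := by
        simp only [hbound]; ring
      have hz : 0 < a n / u := by positivity
      have hTn := hpos (a n)
      have h3 := hH0 _ hz
      have h4 := hΦ0 _ hz
      have hb0 : 0 ≤ bound u := by rw [hbu]; positivity
      by_cases hmem : u ∈ Set.Iic (a n / x₀)
      · simp only [hp]
        rw [Set.indicator_of_mem hmem, Real.norm_of_nonneg (by positivity), hbu]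
        exact mul_le_mul (h2 u hu) (h1 u hu hmem) (by positivity) (by positivity)
      · simp only [hp]
        rw [Set.indicator_of_notMem hmem, norm_zero]
        exact hb0
    · refine (ae_restrict_iff' measurableSet_Ioi).2 (Eventually.of_forall fun u hu => ?_)
      have hu : 0 < u := hu
      have hau : Tendsto (fun n => a n / u) atTop atTop := ha.atTop_div_const hu
      have l1 : Tendsto (fun n => H (a n / u) / T (a n)) atTop (𝓝 (G * u)) := by
        have h1 := (hHlim.comp hau).mul ((hRV u⁻¹ (by positivity)).comp ha)
        rw [inv_inv] at h1
        refine h1.congr fun n => ?_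
        have := (hpos (a n / u)).ne'
        simp only [Function.comp, ← div_eq_inv_mul]
        field_simp
      have l2 : Tendsto (fun n : ℕ => (n : ℝ) * (1 - Φ (a n / u))) atTop (𝓝 u) := by
        have h1 := ((hΦlim.comp hau).mul ((tendsto_averageTail_mul_div hT hpos hb hRV
          (inv_pos.2 hu)).comp ha)).mul hna
        rw [inv_inv, one_mul, mul_one] at h1
        refine h1.congr fun n => ?_
        have := (hA (a n / u)).ne'
        have := (hA (a n)).ne'
        simp only [Function.comp, ← div_eq_inv_mul]
        field_simp
      have l3 : Tendsto (fun n : ℕ => Φ (a n / u)) atTop (𝓝 1) := by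
        have h1 := l2.mul tendsto_inv_atTop_nhds_zero_nat
        rw [mul_zero] at h1
        have h2 := h1.const_sub 1
        rw [sub_zero] at h2
        refine h2.congr' ?_
        filter_upwards [eventually_gt_atTop 0] with n hn
        have : (n : ℝ) ≠ 0 := by positivity
        field_simp
        ring
      have l4 : Tendsto (fun n : ℕ => Φ (a n / u) ^ n) atTop (𝓝 (Real.exp (-u))) := by
        have h1 := Real.tendsto_one_add_pow_exp_of_tendsto
          (g := fun n => -(1 - Φ (a n / u))) (t := -u) (by simpa only [mul_neg] using l2.neg)
        simpa using h1
      have l5 : Tendsto (fun n : ℕ => Φ (a n / u) ^ (n - 1)) atTop (𝓝 (Real.exp (-u))) := by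
        have h1 := l4.div l3 one_ne_zero
        rw [div_one] at h1
        refine h1.congr' ?_
        filter_upwards [l3.eventually_ne one_ne_zero, eventually_ge_atTop 1] with n hn hn1
        simp only [Pi.div_apply]
        rw [pow_sub₀ _ hn hn1, pow_one, div_eq_mul_inv]
      have l6 := (l1.const_mul u⁻¹).mul l5
      rw [show u⁻¹ * (G * u) * Real.exp (-u) = G * Real.exp (-u) by field_simp] at l6
      refine l6.congr' ?_
      filter_upwards [ha.eventually_ge_atTop (u * x₀)] with n hn
      simp only [hp]
      rw [Set.indicator_of_mem]
      rw [Set.mem_Iic, le_div_iff₀ hx₀]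
      exact hn
  rw [integral_const_mul, integral_exp_neg_Ioi_zero, mul_one] at hmain
  have hsum := hmain.add hrem
  rw [add_zero] at hsum
  refine hsum.congr' ?_
  filter_upwards [ha.eventually_gt_atTop 0] with n hn
  have hx0inv : 0 ≤ x₀⁻¹ := by positivity
  rw [← hmaineq n hn, ← add_div, ← setIntegral_union (Set.Ioc_disjoint_Ioi le_rfl) measurableSet_Ioi
      ((hqi n).mono_set Set.Ioc_subset_Ioi_self) ((hqi n).mono_set (Set.Ioi_subset_Ioi hx0inv)),
    Set.Ioc_union_Ioi_eq_Ioi hx0inv]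

end LaplaceMethod

section Moments

variable {Ω : Type*} [MeasurableSpace Ω] {μ : Measure Ω} [IsProbabilityMeasure μ]

lemma antitone_measureReal_lt (X : Ω → ℝ) : Antitone fun x => μ.real {ω | x < X ω} :=
  fun _ _ hxy => measureReal_mono fun _ hω => lt_of_le_of_lt hxy hω

/-- Moments of self-normalised summands with regularly varying tail of index `-1`. -/
lemma tendsto_integral_div_sum_rpow_div {X : ℕ → Ω → ℝ} (hX : ∀ i, Measurable (X i))
    (hX0 : ∀ i ω, 0 ≤ X i ω) (hindep : iIndepFun X μ)
    (hident : ∀ i, IdentDistrib (X i) (X 0) μ μ) {T : ℝ → ℝ}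
    (hTdef : ∀ x, T x = μ.real {ω | x < X 0 ω}) (hpos : ∀ x, 0 < T x)
    (hRV : ∀ r : ℝ, 0 < r → Tendsto (fun x => T (r * x) / T x) atTop (𝓝 r⁻¹)) {a : ℕ → ℝ}
    (ha : Tendsto a atTop atTop)
    (hna : Tendsto (fun n : ℕ => n * averageTail T (a n)) atTop (𝓝 1)) {γ : ℝ} (hγ : 1 < γ) :
    Tendsto (fun n => (∫ ω, (X 0 ω / ∑ k ∈ Finset.range n, X k ω) ^ γ ∂μ) / T (a n)) atTop
      (𝓝 (1 / (γ - 1))) := by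
  have hT : Antitone T := by
    rw [show T = fun x => μ.real {ω | x < X 0 ω} from funext hTdef]
    exact antitone_measureReal_lt (X 0)
  have hb : ∀ x, T x ≤ 1 := fun x => hTdef x ▸ measureReal_le_one
  set H : ℝ → ℝ := fun z => ∫ ω, (X 0 ω / z) ^ γ * Real.exp (-(X 0 ω / z)) ∂μ with hHdef
  set Φ : ℝ → ℝ := fun z => ∫ ω, Real.exp (-(X 0 ω / z)) ∂μ with hΦdef
  have hHeq : ∀ z > 0, H z = ∫ x in Set.Ioi 0, gammaKernelDeriv γ x * T (z * x) := fun z hz => by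
    simp only [hTdef]
    exact integral_rpow_mul_exp_neg_div (hX 0) (hX0 0) hγ hz
  have hΦeq : ∀ z > 0, 1 - Φ z = ∫ x in Set.Ioi 0, Real.exp (-x) * T (z * x) := fun z hz => by
    simp only [hTdef]
    exact one_sub_integral_exp_neg_div (hX 0) (hX0 0) hz
  obtain ⟨C, -, hC⟩ := exists_integral_gammaKernelDeriv_le hT hpos hb (hRV 2 two_pos) hγ
  have hid := integrableOn_and_integral_div_sum_rpow hX hX0 hindep hident hγ
  have hlim := tendsto_integral_inv_mul_pow_div hT hpos hb hRV ha hna (H := H) (Φ := Φ)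
    (G := Real.Gamma (γ - 1)) (C := C) ?_ ?_ ?_ (fun m => (hid m).1) ?_ ?_ ?_ ?_
  · have hγ1 : γ - 1 ≠ 0 := by linarith
    have hΓ1 := (Real.Gamma_pos_of_pos (show 0 < γ - 1 by linarith)).ne'
    have hΓ := (Real.Gamma_pos_of_pos (show 0 < γ by linarith)).ne'
    have hG : Real.Gamma γ = (γ - 1) * Real.Gamma (γ - 1) := by
      rw [← Real.Gamma_add_one hγ1, sub_add_cancel]
    have h1 := hlim.const_mul (Real.Gamma γ)⁻¹
    rw [show (Real.Gamma γ)⁻¹ * Real.Gamma (γ - 1) = 1 / (γ - 1) by rw [hG]; field_simp] at h1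
    refine h1.congr' ?_
    filter_upwards [eventually_ge_atTop 1] with n hn
    have h2 := (hid (n - 1)).2
    rw [Nat.sub_add_cancel hn] at h2
    simp only [hHdef, hΦdef]
    rw [h2]
    field_simp
  · intro z hz
    exact integral_nonneg fun ω => by
      have := hX0 0 ω
      simp only [Pi.zero_apply]; positivity
  · intro z hz
    rw [hHeq z hz]
    exact hC z hz
  · refine (tendsto_integral_gammaKernelDeriv_mul_div hT hpos hb hRV hγ).congr' ?_
    filter_upwards [eventually_gt_atTop 0] with z hz
    rw [hHeq z hz]
  · intro z _
    exact integral_nonneg fun ω => (Real.exp_pos _).le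
  · intro y hy z hz hyz
    have h1 := hΦeq y hy
    have h2 := hΦeq z hz
    have h3 : ∫ x in Set.Ioi 0, Real.exp (-x) * T (z * x) ≤
        ∫ x in Set.Ioi 0, Real.exp (-x) * T (y * x) := by
      refine setIntegral_mono_on
        (integrableOn_mul_comp_mul hT hpos hb (integrableOn_exp_neg_Ioi 0) z)
        (integrableOn_mul_comp_mul hT hpos hb (integrableOn_exp_neg_Ioi 0) y)
        measurableSet_Ioi fun x hx => ?_
      have hx : 0 < x := hx
      gcongr
      exact hT (by gcongr)
    linarith
  · intro z hz
    rw [hΦeq z hz]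
    simpa using le_integral_exp_neg_mul hT hpos hb one_pos z
  · refine (tendsto_integral_exp_neg_mul_div hT hpos hb hRV).congr' ?_
    filter_upwards [eventually_gt_atTop 0] with z hz
    rw [hΦeq z hz]

lemma tendsto_integral_tail_atTop {X : Ω → ℝ} (hX : Measurable X) (hX0 : ∀ ω, 0 ≤ X ω)
    (hinf : ∫⁻ ω, ENNReal.ofReal (X ω) ∂μ = ⊤) :
    Tendsto (fun x => ∫ t in (0 : ℝ)..x, μ.real {ω | t < X ω}) atTop atTop := by
  have hT := antitone_measureReal_lt (μ := μ) X
  have hmono : Monotone fun x => ∫ t in (0 : ℝ)..x, μ.real {ω | t < X ω} := by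
    intro y z hyz
    have h1 := le_integral_sub_integral_of_antitone hT hyz
    have h2 : 0 ≤ (z - y) * μ.real {ω | z < X ω} :=
      mul_nonneg (by linarith) measureReal_nonneg
    simp only at h1 ⊢
    linarith
  refine tendsto_atTop_atTop_of_monotone hmono fun b => ?_
  by_contra! hcon
  have hInt : IntegrableOn (fun t => μ.real {ω | t < X ω}) (Set.Ioi 0) := by
    refine integrableOn_Ioi_of_intervalIntegral_norm_bounded (b := id) (l := atTop) b 0 (fun x => ?_)
      tendsto_id (Eventually.of_forall fun x => ?_)
    · rcases le_total 0 x with hx | hx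
      · exact (intervalIntegrable_iff_integrableOn_Ioc_of_le hx).1 hT.intervalIntegrable
      · simp [Set.Ioc_eq_empty_of_le hx]
    · simpa [Real.norm_of_nonneg measureReal_nonneg] using (hcon x).le
  have h1 := hInt.lintegral_lt_top
  rw [lintegral_eq_lintegral_meas_lt μ (Eventually.of_forall hX0) hX.aemeasurable] at hinf
  rw [lintegral_congr fun t => ofReal_measureReal (measure_ne_top _ _)] at h1
  exact h1.ne hinf

end Moments

section SlowVariation

variable {T ℓ : ℝ → ℝ}

lemma SlowlyVarying.eventually_pos (hℓ : SlowlyVarying ℓ) : ∀ᶠ x in atTop, 0 < ℓ x := by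
  obtain ⟨⟨X, hX, -⟩, -⟩ := hℓ
  filter_upwards [eventually_ge_atTop X] with x hx using hX x hx

lemma SlowlyVarying.pos_of_isEquivalent (hℓ : SlowlyVarying ℓ) (hT : Antitone T)
    (h : T ~[atTop] fun x => ℓ x * x⁻¹) (x : ℝ) : 0 < T x := by
  have h1 := h.isLittleO.def (show (0 : ℝ) < 1 / 2 by norm_num)
  obtain ⟨y, hy, hy1, hy0, hyx⟩ := (h1.and (hℓ.eventually_pos.and
    ((eventually_gt_atTop 0).and (eventually_ge_atTop x)))).exists
  have h2 : 0 < ℓ y * y⁻¹ := by positivity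
  simp only [Pi.sub_apply, Real.norm_eq_abs, abs_of_pos h2] at hy
  have := (abs_le.1 hy).1
  have := hT hyx
  linarith

lemma SlowlyVarying.tendsto_mul_div (hℓ : SlowlyVarying ℓ)
    (h : T ~[atTop] fun x => ℓ x * x⁻¹) {r : ℝ} (hr : 0 < r) :
    Tendsto (fun x => T (r * x) / T x) atTop (𝓝 r⁻¹) := by
  have hrx : Tendsto (fun x : ℝ => r * x) atTop atTop := tendsto_id.const_mul_atTop hr
  have h1 := (h.comp_tendsto hrx).div h
  refine h1.symm.tendsto_nhds ?_
  have h2 := (hℓ.2 r hr).mul_const r⁻¹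
  rw [one_mul] at h2
  refine h2.congr' ?_
  filter_upwards [eventually_gt_atTop 0, hℓ.eventually_pos] with x hx hlx
  simp only [Function.comp, Pi.div_apply]
  field_simp

lemma SlowlyVarying.exists_admissibleLowerLimit (hℓ : SlowlyVarying ℓ) (hb : ∀ x, T x ≤ 1)
    (h : T ~[atTop] fun x => ℓ x * x⁻¹) : ∃ c, AdmissibleLowerLimit ℓ c := by
  obtain ⟨X, hXpos, hXm⟩ := hℓ.1
  obtain ⟨x₀, hx₀⟩ := eventually_atTop.1 (h.isLittleO.def (show (0 : ℝ) < 1 / 2 by norm_num))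
  set c := max (max X x₀) 1
  have hcX : X ≤ c := (le_max_left _ _).trans (le_max_left _ _)
  have hcx : x₀ ≤ c := (le_max_right _ _).trans (le_max_left _ _)
  have hc1 : 1 ≤ c := le_max_right _ _
  refine ⟨c, by linarith, fun x hx => ?_⟩
  rw [intervalIntegrable_iff_integrableOn_Ioc_of_le hx]
  have hm : AEMeasurable ℓ (volume.restrict (Set.Ioc c x)) := by
    have h1 : AEMeasurable ℓ (volume.restrict (Set.Ici X)) :=
      (aemeasurable_restrict_iff_comap_subtype measurableSet_Ici).2 hXm.aemeasurable
    exact h1.mono_measure (Measure.restrict_mono (fun t ht => hcX.trans ht.1.le) le_rfl)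
  refine Integrable.mono' (g := fun _ => (2 : ℝ)) (integrable_const _) (f := fun t => ℓ t / t)
    (hm.div measurable_id.aemeasurable).aestronglyMeasurable ?_
  refine (ae_restrict_iff' measurableSet_Ioc).2 (Eventually.of_forall fun t ht => ?_)
  have ht0 : 0 < t := by linarith [ht.1]
  have hlt := hXpos t (hcX.trans ht.1.le)
  have h2 := hx₀ t (hcx.trans ht.1.le)
  have h3 : 0 < ℓ t * t⁻¹ := by positivity
  simp only [Pi.sub_apply, Real.norm_eq_abs, abs_of_pos h3] at h2
  have h4 := (abs_le.1 h2).1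
  have h5 := hb t
  rw [Real.norm_of_nonneg (by positivity), div_eq_mul_inv]
  linarith

lemma tailIntegral_isEquivalent (hT : Antitone T) (hpos : ∀ x, 0 < T x)
    (h : T ~[atTop] fun x => ℓ x * x⁻¹)
    (hM : Tendsto (fun x => ∫ t in (0 : ℝ)..x, T t) atTop atTop) {c : ℝ}
    (hc : AdmissibleLowerLimit ℓ c) :
    tailIntegral ℓ c ~[atTop] fun x => ∫ t in (0 : ℝ)..x, T t := by
  refine IsLittleO.of_bound fun ε hε => ?_
  have hsymm : (fun x => ℓ x * x⁻¹) ~[atTop] T := h.symm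
  obtain ⟨x₁, hx₁⟩ := eventually_atTop.1 (hsymm.isLittleO.def (half_pos hε))
  set x₀ := max x₁ c
  have hcx : c ≤ x₀ := le_max_right _ _
  have hx00 : 0 ≤ x₀ := hc.1.trans hcx
  set K := |tailIntegral ℓ c x₀ - ∫ t in (0 : ℝ)..x₀, T t|
  filter_upwards [eventually_ge_atTop x₀, hM.eventually_ge_atTop (K / (ε / 2))] with x hx hMx
  have hMx0 : 0 ≤ ∫ t in (0 : ℝ)..x₀, T t :=
    intervalIntegral.integral_nonneg hx00 fun t _ => (hpos t).le
  have hK : K ≤ ε / 2 * ∫ t in (0 : ℝ)..x, T t := by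
    rwa [div_le_iff₀ (half_pos hε), mul_comm] at hMx
  have hMpos : 0 ≤ ∫ t in (0 : ℝ)..x, T t :=
    intervalIntegral.integral_nonneg (hx00.trans hx) fun t _ => (hpos t).le
  have hi1 := hc.2 x₀ hcx
  have hi2 := hc.2 x (hcx.trans hx)
  have hi3 : IntervalIntegrable (fun t => ℓ t / t) volume x₀ x := hi1.symm.trans hi2
  have hL : tailIntegral ℓ c x = tailIntegral ℓ c x₀ + ∫ t in x₀..x, ℓ t / t :=
    (intervalIntegral.integral_add_adjacent_intervals hi1 hi3).symm
  have hMa : ∫ t in (0 : ℝ)..x, T t = (∫ t in (0 : ℝ)..x₀, T t) + ∫ t in x₀..x, T t :=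
    (intervalIntegral.integral_add_adjacent_intervals hT.intervalIntegrable
      hT.intervalIntegrable).symm
  have hdiff : |(∫ t in x₀..x, ℓ t / t) - ∫ t in x₀..x, T t| ≤ ε / 2 * ∫ t in x₀..x, T t := by
    rw [← intervalIntegral.integral_sub hi3 hT.intervalIntegrable,
      ← intervalIntegral.integral_const_mul, ← Real.norm_eq_abs]
    refine intervalIntegral.norm_integral_le_of_norm_le hx (Eventually.of_forall fun t ht => ?_)
      (hT.intervalIntegrable.const_mul _)
    have := hx₁ t ((le_max_left _ _).trans ht.1.le)
    simpa [abs_of_pos (hpos t), div_eq_mul_inv] using this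
  rw [Pi.sub_apply, Real.norm_of_nonneg hMpos, Real.norm_eq_abs]
  calc |tailIntegral ℓ c x - ∫ t in (0 : ℝ)..x, T t|
      = |(tailIntegral ℓ c x₀ - ∫ t in (0 : ℝ)..x₀, T t) +
          ((∫ t in x₀..x, ℓ t / t) - ∫ t in x₀..x, T t)| := by
        rw [hL, hMa]; congr 1; ring
    _ ≤ K + ε / 2 * ∫ t in x₀..x, T t := (abs_add_le _ _).trans (by gcongr)
    _ ≤ ε / 2 * (∫ t in (0 : ℝ)..x, T t) + ε / 2 * ∫ t in (0 : ℝ)..x, T t := by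
        gcongr
        linarith
    _ = _ := by ring

lemma tendsto_averageTail_zero (hT : Antitone T) (hpos : ∀ x, 0 < T x) (hb : ∀ x, T x ≤ 1)
    (hRV : ∀ r : ℝ, 0 < r → Tendsto (fun x => T (r * x) / T x) atTop (𝓝 r⁻¹)) :
    Tendsto (averageTail T) atTop (𝓝 0) := by
  have hA := averageTail_pos hT hpos hb
  obtain ⟨x₀, hx₀, hlow⟩ := exists_rpow_mul_le_of_tendsto_half (averageTail_antitone hT hpos hb) hA
    (tendsto_averageTail_mul_div hT hpos hb hRV two_pos) (s := 1 / 2) (by norm_num) (by norm_num)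
  have hlim : Tendsto (fun z : ℝ => (2 : ℝ) ^ (1 / 2 : ℝ) * averageTail T x₀ /
      (z / x₀) ^ (1 / 2 : ℝ)) atTop (𝓝 0) :=
    ((tendsto_rpow_atTop (by norm_num)).comp (tendsto_id.atTop_div_const hx₀)).const_div_atTop _
  refine squeeze_zero' (Eventually.of_forall fun z => (hA z).le) ?_ hlim
  filter_upwards [eventually_ge_atTop x₀] with z hz
  have hz0 : 0 < z := hx₀.trans_le hz
  rw [le_div_iff₀ (by positivity), mul_comm]
  exact hlow x₀ z le_rfl hz

lemma exists_tendsto_mul_averageTail (hT : Antitone T) (hpos : ∀ x, 0 < T x)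
    (hb : ∀ x, T x ≤ 1)
    (hRV : ∀ r : ℝ, 0 < r → Tendsto (fun x => T (r * x) / T x) atTop (𝓝 r⁻¹)) :
    ∃ a : ℕ → ℝ, Tendsto a atTop atTop ∧
      Tendsto (fun n : ℕ => n * averageTail T (a n)) atTop (𝓝 1) := by
  have hA := averageTail_pos hT hpos hb
  have hlim := tendsto_averageTail_zero hT hpos hb hRV
  have hcont : ContinuousOn (averageTail T) (Set.Ici 1) := by
    have h1 : Continuous fun x => ∫ t in (0 : ℝ)..x, T t :=
      intervalIntegral.continuous_primitive (fun _ _ => hT.intervalIntegrable) 0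
    refine ContinuousOn.congr (f := fun x => (∫ t in (0 : ℝ)..x, T t) / x)
      (h1.continuousOn.div continuousOn_id fun x hx => ?_) fun x hx => ?_
    · exact (zero_lt_one.trans_le hx).ne'
    · exact averageTail_eq (zero_lt_one.trans_le hx)
  obtain ⟨N, hN⟩ := exists_nat_gt (averageTail T 1)⁻¹
  have hex : ∀ n : ℕ, ∃ x, N ≤ n → 1 ≤ x ∧ n * averageTail T x = 1 := by
    intro n
    by_cases hn : N ≤ n
    · have hn' : (averageTail T 1)⁻¹ < n := hN.trans_le (by exact_mod_cast hn)
      have hn0 : (0 : ℝ) < n := (inv_pos.2 (hA 1)).trans hn'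
      obtain ⟨b, hb1, hb2⟩ := ((hlim.eventually_lt_const (inv_pos.2 hn0)).and
        (eventually_ge_atTop 1)).exists
      obtain ⟨x, hx, hxe⟩ := intermediate_value_Icc' hb2 (hcont.mono Set.Icc_subset_Ici_self)
        ⟨hb1.le, (inv_lt_of_inv_lt₀ (hA 1) hn').le⟩
      exact ⟨x, fun _ => ⟨hx.1, by rw [hxe, mul_inv_cancel₀ hn0.ne']⟩⟩
    · exact ⟨0, fun h => absurd h hn⟩
  choose a ha using hex
  refine ⟨a, ?_, ?_⟩
  · refine tendsto_atTop_mono' atTop ?_ (tendsto_natCast_atTop_atTop.atTop_mul_const (hA 1))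
    filter_upwards [eventually_ge_atTop N] with n hn
    obtain ⟨h1, h2⟩ := ha n hn
    have h3 := le_integral_sub_integral_of_antitone hT h1
    have h4 : 0 ≤ (a n - 1) * T (a n) := mul_nonneg (by linarith) (hpos _).le
    have h5 : averageTail T 1 ≤ a n * averageTail T (a n) := by
      have := mul_averageTail (T := T) 1
      rw [one_mul] at this
      rw [mul_averageTail, this]
      linarith
    calc (n : ℝ) * averageTail T 1 ≤ n * (a n * averageTail T (a n)) := by gcongr
      _ = a n * (n * averageTail T (a n)) := by ring
      _ = a n := by rw [h2, mul_one]
  · refine tendsto_const_nhds.congr' ?_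
    filter_upwards [eventually_ge_atTop N] with n hn
    exact (ha n hn).2.symm

lemma isNormingSequence_iff {L : ℝ → ℝ} (hL : L ~[atTop] fun x => ∫ t in (0 : ℝ)..x, T t)
    {a : ℕ → ℝ} : IsNormingSequence L a ↔ Tendsto a atTop atTop ∧
      Tendsto (fun n : ℕ => n * averageTail T (a n)) atTop (𝓝 1) := by
  refine and_congr_right fun ha => ?_
  have h1 : (fun n : ℕ => (n : ℝ) * L (a n)) ~[atTop]
      fun n : ℕ => (n : ℝ) * ∫ t in (0 : ℝ)..a n, T t :=
    IsEquivalent.refl.mul (hL.comp_tendsto ha)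
  have h2 : (a ~[atTop] fun n : ℕ => (n : ℝ) * L (a n)) ↔
      (fun n : ℕ => (n : ℝ) * ∫ t in (0 : ℝ)..a n, T t) ~[atTop] a :=
    ⟨fun h => (h.trans h1).symm, fun h => (h1.trans h).symm⟩
  rw [h2, isEquivalent_iff_tendsto_one]
  · refine tendsto_congr' ?_
    filter_upwards [ha.eventually_gt_atTop 0] with n hn
    rw [Pi.div_apply, ← mul_averageTail]
    field_simp
  · filter_upwards [ha.eventually_gt_atTop 0] with n hn using hn.ne'

end SlowVariation

lemma abs_selfNormRatio_rpow {Ω : Type*} (Y : ℕ → Ω → ℝ) (k n : ℕ) (ω : Ω) (γ : ℝ) :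
    |selfNormRatio Y k n ω| ^ (2 * γ) =
      (Y k ω ^ 2 / ∑ j ∈ Finset.range n, Y j ω ^ 2) ^ γ := by
  rw [Real.rpow_mul (abs_nonneg _), Real.rpow_two, sq_abs, selfNormRatio, selfNorm, div_pow,
    Real.sq_sqrt (Finset.sum_nonneg fun i _ => sq_nonneg _)]

theorem mainTheorem5 {Ω : Type*} [MeasurableSpace Ω] (μ : Measure Ω) [IsProbabilityMeasure μ]
    (Y : ℕ → Ω → ℝ) (hmeas : ∀ i, Measurable (Y i))
    (hindep : iIndepFun Y μ) (hident : ∀ i, IdentDistrib (Y i) (Y 0) μ μ)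
    (ℓ : ℝ → ℝ) (hℓ : SlowlyVarying ℓ)
    (htail : (fun x : ℝ => μ.real {ω | x < Y 0 ω ^ 2}) ~[atTop] fun x => ℓ x * x⁻¹)
    (hinf : ∫⁻ ω, ENNReal.ofReal (Y 0 ω ^ 2) ∂μ = ⊤) :
    (∃ c : ℝ, AdmissibleLowerLimit ℓ c) ∧
    ∀ c : ℝ, AdmissibleLowerLimit ℓ c →
      (∃ a : ℕ → ℝ, IsNormingSequence (tailIntegral ℓ c) a) ∧
      ∀ a : ℕ → ℝ, IsNormingSequence (tailIntegral ℓ c) a →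
        ∀ γ : ℝ, 1 < γ →
          (fun n : ℕ => (n : ℝ) * ∫ ω, |selfNormRatio Y 0 n ω| ^ (2 * γ) ∂μ) ~[atTop]
            fun n => 1 / (γ - 1) * (ℓ (a n) / tailIntegral ℓ c (a n)) := by
  set T : ℝ → ℝ := fun x => μ.real {ω | x < Y 0 ω ^ 2} with hTdef
  have hT : Antitone T := antitone_measureReal_lt fun ω => Y 0 ω ^ 2
  have hb : ∀ x, T x ≤ 1 := fun x => measureReal_le_one
  have hpos : ∀ x, 0 < T x := hℓ.pos_of_isEquivalent hT htail
  have hRV : ∀ r : ℝ, 0 < r → Tendsto (fun x => T (r * x) / T x) atTop (𝓝 r⁻¹) :=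
    fun r hr => hℓ.tendsto_mul_div htail hr
  have hM : Tendsto (fun x => ∫ t in (0 : ℝ)..x, T t) atTop atTop :=
    tendsto_integral_tail_atTop ((hmeas 0).pow_const 2) (fun ω => sq_nonneg _) hinf
  refine ⟨hℓ.exists_admissibleLowerLimit hb htail, fun c hc => ?_⟩
  have hL := tailIntegral_isEquivalent hT hpos htail hM hc
  refine ⟨?_, fun a ha γ hγ => ?_⟩
  · obtain ⟨a, ha⟩ := exists_tendsto_mul_averageTail hT hpos hb hRV
    exact ⟨a, (isNormingSequence_iff hL).2 ha⟩
  · obtain ⟨ha1, ha2⟩ := (isNormingSequence_iff hL).1 ha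
    have hsq : Measurable fun y : ℝ => y ^ 2 := by fun_prop
    have hmom := tendsto_integral_div_sum_rpow_div (X := fun i ω => Y i ω ^ 2) (T := T)
      (fun i => (hmeas i).pow_const 2) (fun i ω => sq_nonneg _)
      (hindep.comp (fun _ y => y ^ 2) fun _ => hsq) (fun i => (hident i).comp hsq)
      (fun _ => rfl) hpos hRV ha1 ha2 hγ
    have hγ1 : (1 / (γ - 1) : ℝ) ≠ 0 := one_div_ne_zero (by linarith)
    have hE : (fun n : ℕ => ∫ ω, |selfNormRatio Y 0 n ω| ^ (2 * γ) ∂μ) ~[atTop]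
        fun n => 1 / (γ - 1) * T (a n) := by
      simp only [abs_selfNormRatio_rpow]
      have h1 := ((isEquivalent_const_iff_tendsto hγ1).2 hmom).mul
        (IsEquivalent.refl (u := fun n => T (a n)) (l := atTop))
      refine h1.congr_left (Eventually.of_forall fun n => ?_)
      exact div_mul_cancel₀ _ (hpos (a n)).ne'
    have hTa : (fun n => T (a n)) ~[atTop] fun n => ℓ (a n) * (a n)⁻¹ := htail.comp_tendsto ha1
    have h2 : (fun n : ℕ => (n : ℝ) * ∫ ω, |selfNormRatio Y 0 n ω| ^ (2 * γ) ∂μ) ~[atTop]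
        fun n : ℕ => (n : ℝ) * (1 / (γ - 1) * (ℓ (a n) * ((n : ℝ) * tailIntegral ℓ c (a n))⁻¹)) :=
      IsEquivalent.refl.mul (hE.trans (IsEquivalent.refl.mul (hTa.trans
        (IsEquivalent.refl.mul ha.2.inv))))
    refine h2.congr_right ?_
    filter_upwards [eventually_gt_atTop 0] with n hn
    have : (n : ℝ) ≠ 0 := by positivity
    rw [mul_inv, div_eq_mul_inv (ℓ (a n))]
    field_simp
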